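/- Let $\Omega\subset\mathbb R^2$ be a bounded connected open set with Lipschitz boundary, $I\subset\mathbb R$ a non-degenerate interval, and let $\partial\Omega$ be partitioned into measurable parts $\Gamma_N,\Gamma_D,\Gamma_R,\Gamma_\sharp$, where $\Gamma_\sharp$ is the union of finitely many sets $A_k$ and of their translates $A_k+v_k$. Let $c,\sigma\in L^\infty(\Omega)$ be bounded below by positive constants, $a\in L^\infty(\Gamma_R)$ with $a>0$, and $h\in L^\infty(\Omega)\cap H^1(\Omega)$. Let $\mu$ (a constant, or a function on $\Omega$) be such that $f:=\mu|\nabla h|^2\in L^2(\Omega)$. Here $\nabla$ and $\operatorname{div}$ act in the variables of $\Omega$. Consider the Graetz equation with viscosity $$c\,\partial_{zz}T+\operatorname{div}(\sigma\nabla T)-h\,\partial_zT=\mu|\nabla h|^2\quad\text{on }\Omega\times I\qquad(1)$$ and the Graetz equation without viscosity $$c\,\partial_{zz}T+\operatorname{div}(\sigma\nabla T)-h\,\partial_zT=0\quad\text{on }\Omega\times I,\qquad(2)$$ both with the lateral boundary conditions $\sigma\nabla T\cdot n=0$ on $\Gamma_N$, $T=0$ on $\Gamma_D$, $\sigma\nabla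 T\cdot n+aT=0$ on $\Gamma_R$, and periodicity on $\Gamma_\sharp$ ($T(x+v_k)=T(x)$ for $x\in A_k$, with the corresponding natural condition on the flux). Solutions are functions $T\in C^1(I,L^2(\Omega))\cap C^0(I,H^1(\Omega))$ that satisfy the equation and the boundary conditions in the weak sense in $\Omega$: with $V$ the space of $s\in H^1(\Omega)$ that vanish on $\Gamma_D$ and are periodic on $\Gamma_\sharp$ (in the sense of traces), $T(z)\in V$ for all $z\in I$ and, for all $v\in V$ and $z\in I$ (with $f$ replaced by $0$ for (2)), $$\frac{d}{dz}\int_\Omega c\,\partial_zT\,v=\int_\Omega\sigma\nabla T\cdot\nabla v+\int_{\Gamma_R}aTv+\int_\Omega h\,\partial_zT\,v+\int_\Omega fv .$$ For $g\in L^2(\Omega)$ write $u=\Delta_\sigma^{-1}g$ if $u\in V$ and $\int_\Omega\sigma\nabla u\cdot\nabla v+\int_{\Gamma_R}auv=-\int_\Omega gv$ for all $v\in V$, i.e. $\operatorname{div}(\sigma\nabla u)=g$ with the lateral boundary conditions. The constants are said to be controlled if $\Gamma_D\cup\Gamma_R\neq\emptyset$ (up to sets of length zero). In each of the following cases the function $\widetilde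 T$ is well defined and is a solution of (1), and a function $T$ is a solution of (1) if and only if $T-\widetilde T$ is a solution of (2); thus the problem with viscosity reduces to the problem without viscosity. a) If the constants are controlled, there is exactly one $\Delta_\sigma^{-1}(\mu|\nabla h|^2)$, and $$\widetilde T=\Delta_\sigma^{-1}(\mu|\nabla h|^2).$$ b) If the constants are not controlled and $\int_\Omega h\neq0$ (non-balanced case), there is exactly one $\alpha\in\mathbb R$ with $\int_\Omega(\mu|\nabla h|^2+\alpha h)=0$; for it, $\Delta_\sigma^{-1}(\mu|\nabla h|^2+\alpha h)$ exists and is unique up to an additive constant, and, for any choice of this constant, $$\widetilde T=\alpha z+\Delta_\sigma^{-1}(\mu|\nabla h|^2+\alpha h).$$ c) If the constants are not controlled and $\int_\Omega h=0$ (balanced case), $w=\Delta_\sigma^{-1}h$ exists and is unique up to an additive constant; for any choice of $w$, $$\int_\Omega(c-hw)=\int_\Omega c+\int_\Omega\sigma|\nabla w|^2>0,$$ so that there is exactly one $\alpha\in\mathbb R$ with $\alpha\int_\Omega(c-hw)=\int_\Omega\mu|\nabla h|^2$. The function $\gamma=\mu|\nabla h|^2-\alpha(c-hw)$ belongs to $L^2(\Omega)$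 and has zero average, $\Delta_\sigma^{-1}\gamma$ exists and is unique up to an additive constant, and, for any choice of this constant, $$\widetilde T=\alpha\Big(\frac{z^2}{2}+z\,w\Big)+\Delta_\sigma^{-1}\gamma .$$ -/

import Mathlib

open MeasureTheory Filter Topology
open scoped ENNReal NNReal ContDiff

noncomputable section

namespace Graetz

/-- The plane with its Euclidean norm; it contains the cross section of the pipe. -/
abbrev Plane : Type := EuclideanSpace ℝ (Fin 2)

/-- Lipschitz boundary: near each boundary point, in suitable rotated coordinates, `Ω` is the set of
points strictly below the graph of a Lipschitz function. -/
def HasLipschitzBoundary (Ω : Set Plane) : Prop :=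
  ∀ p ∈ frontier Ω, ∃ (e : Plane ≃ₗᵢ[ℝ] Plane) (K : ℝ≥0) (φ : ℝ → ℝ) (r : ℝ),
    LipschitzWith K φ ∧ 0 < r ∧ ∀ x ∈ Metric.ball p r, (x ∈ Ω ↔ (e x) 1 < φ ((e x) 0))

/-- `u ∈ H¹(Ω)` with weak gradient `G`. -/
structure IsWeakGradient (Ω : Set Plane) (u : Plane → ℝ) (G : Plane → Plane) : Prop where
  memLp : MemLp u 2 (volume.restrict Ω)
  memLp_grad : MemLp G 2 (volume.restrict Ω)
  integral_eq : ∀ φ : Plane → ℝ, ContDiff ℝ ∞ φ → HasCompactSupport φ → tsupport φ ⊆ Ω →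
    ∀ e : Plane, ∫ x in Ω, u x * fderiv ℝ φ x e = - ∫ x in Ω, inner ℝ (G x) e * φ x

/-- The arc-length measure on `∂Ω`. -/
abbrev bdryMeasure (Ω : Set Plane) : Measure Plane := (μH[1]).restrict (frontier Ω)

/-- `g` is the boundary trace of the `H¹(Ω)` function `u` with gradient `G`: some functions smooth
up to the boundary converge to `u` in `H¹(Ω)` and their boundary values converge to `g` in
`L²(∂Ω)`. -/
def HasTrace (Ω : Set Plane) (u : Plane → ℝ) (G : Plane → Plane) (g : Plane → ℝ) : Prop :=
  ∃ φ : ℕ → Plane → ℝ, (∀ n, ContDiff ℝ ∞ (φ n)) ∧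
    Tendsto (fun n => eLpNorm (fun x => φ n x - u x) 2 (volume.restrict Ω)) atTop (𝓝 0) ∧
    Tendsto (fun n => eLpNorm (fun x => gradient (φ n) x - G x) 2 (volume.restrict Ω))
      atTop (𝓝 0) ∧
    Tendsto (fun n => eLpNorm (fun x => φ n x - g x) 2 (bdryMeasure Ω)) atTop (𝓝 0)

/-- The data of the Graetz problem: the cross section, the parts of its boundary, the coefficients.
Periodicity identifies each point `x` of `perPart k` with the point `perShift k + x`. -/
structure Setting where
  Ω : Set Plane
  isOpen : IsOpen Ω
  isConnected : IsConnected Ω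
  isBounded : Bornology.IsBounded Ω
  lipschitz : HasLipschitzBoundary Ω
  ΓN : Set Plane
  ΓD : Set Plane
  ΓR : Set Plane
  Γper : Set Plane
  measurable_ΓN : MeasurableSet ΓN
  measurable_ΓD : MeasurableSet ΓD
  measurable_ΓR : MeasurableSet ΓR
  cover : ΓN ∪ ΓD ∪ ΓR ∪ Γper = frontier Ω
  disjoint_ND : Disjoint ΓN ΓD
  disjoint_NR : Disjoint ΓN ΓR
  disjoint_NP : Disjoint ΓN Γper
  disjoint_DR : Disjoint ΓD ΓR
  disjoint_DP : Disjoint ΓD Γper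
  disjoint_RP : Disjoint ΓR Γper
  numPer : ℕ
  perPart : Fin numPer → Set Plane
  perShift : Fin numPer → Plane
  measurable_perPart : ∀ k, MeasurableSet (perPart k)
  Γper_eq : Γper = ⋃ k, (perPart k ∪ (fun x => perShift k + x) '' perPart k)
  /-- longitudinal diffusion coefficient -/
  c : Plane → ℝ
  /-- transverse diffusion coefficient -/
  σ : Plane → ℝ
  /-- velocity profile -/
  h : Plane → ℝ
  /-- Robin coefficient -/
  a : Plane → ℝ
  c_bdd : MemLp c ∞ (volume.restrict Ω)
  c_pos : ∃ m : ℝ, 0 < m ∧ ∀ᵐ x ∂(volume.restrict Ω), m ≤ c x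
  σ_bdd : MemLp σ ∞ (volume.restrict Ω)
  σ_pos : ∃ m : ℝ, 0 < m ∧ ∀ᵐ x ∂(volume.restrict Ω), m ≤ σ x
  h_bdd : MemLp h ∞ (volume.restrict Ω)
  a_bdd : MemLp a ∞ ((μH[1]).restrict ΓR)
  a_pos : ∀ᵐ x ∂((μH[1]).restrict ΓR), 0 < a x

namespace Setting

variable (D : Setting)

instance : IsFiniteMeasure (volume.restrict D.Ω) :=
  ⟨by simpa using D.isBounded.measure_lt_top⟩

/-- `L²(Ω)` -/
abbrev L2 : Type := Lp ℝ 2 (volume.restrict D.Ω)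

/-- `L²(Ω; ℝ²)` -/
abbrev L2vec : Type := Lp Plane 2 (volume.restrict D.Ω)

/-- `L²(∂Ω)` -/
abbrev L2bdry : Type := Lp ℝ 2 (bdryMeasure D.Ω)

/-- The constant function `r` as an element of `L²(Ω)`. -/
def const (r : ℝ) : D.L2 := Lp.const 2 (volume.restrict D.Ω) r

/-- `s` is an `H¹(Ω)` function, with gradient `G` and trace `g`, which vanishes on `ΓD` and is
periodic on `Γper`. -/
structure Admissible (s : D.L2) (G : D.L2vec) (g : D.L2bdry) : Prop where
  grad : IsWeakGradient D.Ω s G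
  trace : HasTrace D.Ω s G g
  dirichlet : ∀ᵐ x ∂((μH[1]).restrict D.ΓD), g x = 0
  periodic : ∀ k, ∀ᵐ x ∂((μH[1]).restrict (D.perPart k)), g (D.perShift k + x) = g x

/-- `∫_Ω σ ∇s·∇s' + ∫_{ΓR} a s s'`: the weak form of `-div (σ ∇ ·)` together with the Neumann
condition on `ΓN`, the Robin condition on `ΓR` and the periodicity of the flux on `Γper`. -/
def form (G : D.L2vec) (g : D.L2bdry) (G' : D.L2vec) (g' : D.L2bdry) : ℝ :=
  (∫ x in D.Ω, D.σ x * inner ℝ (G x) (G' x)) + ∫ x in D.ΓR, D.a x * g x * g' x ∂μH[1]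

/-- `u` is (a representative of) `Δ_σ⁻¹ f`: `div (σ ∇u) = f` with the lateral boundary conditions,
in the weak sense. -/
def IsInvLaplacian (f : Plane → ℝ) (u : D.L2) : Prop :=
  ∃ (G : D.L2vec) (g : D.L2bdry), D.Admissible u G g ∧
    ∀ (v : D.L2) (Gv : D.L2vec) (gv : D.L2bdry), D.Admissible v Gv gv →
      D.form G g Gv gv = - ∫ x in D.Ω, f x * v x

/-- `Δ_σ⁻¹ f` exists and is a single class modulo the constants. -/
def InvLaplacianModConst (f : Plane → ℝ) : Prop :=
  ∃ u : D.L2, ∀ u' : D.L2, D.IsInvLaplacian f u' ↔ ∃ k : ℝ, u' = u + D.const k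

/-- The constants are controlled: `ΓD ∪ ΓR` is non-empty (up to sets of length zero, which the
boundary conditions do not see). -/
def ConstantsControlled : Prop := μH[1] (D.ΓD ∪ D.ΓR) ≠ 0

/-- `T ∈ C¹(I, L²(Ω)) ∩ C⁰(I, H¹(Ω))` solves `c ∂_zz T + div (σ ∇T) - h ∂_z T = f` on `Ω × I` with
the lateral boundary conditions, weakly in the cross section. Here `T'`, `G`, `g` are `∂_z T`, the
transverse gradient and the lateral trace. -/
def IsSolution (I : Set ℝ) (f : Plane → ℝ) (T : ℝ → D.L2) : Prop :=
  ∃ (T' : ℝ → D.L2) (G : ℝ → D.L2vec) (g : ℝ → D.L2bdry),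
    (∀ z ∈ I, HasDerivWithinAt T (T' z) I z) ∧ ContinuousOn T' I ∧ ContinuousOn G I ∧
    (∀ z ∈ I, D.Admissible (T z) (G z) (g z)) ∧
    ∀ (v : D.L2) (Gv : D.L2vec) (gv : D.L2bdry), D.Admissible v Gv gv → ∀ z ∈ I,
      HasDerivWithinAt (fun t => ∫ x in D.Ω, D.c x * T' t x * v x)
        (D.form (G z) (g z) Gv gv + (∫ x in D.Ω, D.h x * T' z x * v x) + ∫ x in D.Ω, f x * v x)
        I z

/-- `S` is a particular solution for the source `f`, and the change of unknown `T ↦ T - S` turns the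
problem with source `f` into the problem without source, and conversely. -/
def Reduces (I : Set ℝ) (f : Plane → ℝ) (S : ℝ → D.L2) : Prop :=
  D.IsSolution I f S ∧
    ∀ T : ℝ → D.L2, D.IsSolution I f T ↔ D.IsSolution I (fun _ => 0) (fun z => T z - S z)

end Setting

/-- The viscous source `μ |∇h|²`. -/
def viscousSource (μ : Plane → ℝ) (gradh : Plane → Plane) : Plane → ℝ :=
  fun x => μ x * ‖gradh x‖ ^ 2

end Graetz

end

/-!
The particular solution is sought as a polynomial `(z² / 2) u₂ + z u₁ + u₀` in `z`. Matching the
powers of `z` turns the equation into three Poisson problems in the cross section, with sources `0`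
for `u₂`, `h u₂` for `u₁` and `f + h u₁ - c u₂` for `u₀`. When the constants are controlled, every
source is admissible, and `u₂ = u₁ = 0`. Otherwise the constants solve the homogeneous problem and a
source is admissible iff it has zero average: `u₂ = 0` and `u₁ = α` in the non-balanced case,
`u₂ = α` and `u₁ = α w` in the balanced case, and the solvability of the last problem fixes `α`.
Testing the equation of `w` with `w` itself gives `-∫ h w = ∫ σ |∇w|²`, so the coefficient of `α`
does not vanish.

The Poisson problems are solved by the Lax-Milgram theorem. Coercivity comes from the Poincaré and
trace inequalities on `Ω`, which hold on the region below a Lipschitz graph by integration along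
vertical segments, and pass to `Ω` by chaining overlapping charts.
-/

noncomputable section

namespace Graetz

/-! ### Poincaré and trace inequalities below a graph -/

section RegionBetween

theorem enorm_add_sq_le {E : Type*} [NormedAddCommGroup E] (x y : E) :
    ‖x + y‖ₑ ^ 2 ≤ 2 * (‖x‖ₑ ^ 2 + ‖y‖ₑ ^ 2) := by
  have h := ENNReal.rpow_add_le_mul_rpow_add_rpow ‖x‖ₑ ‖y‖ₑ one_le_two
  norm_num at h
  exact (pow_le_pow_left' (enorm_add_le x y) 2).trans h

variable {α β E F : Type*} [MeasurableSpace α] [MeasurableSpace β]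
  [NormedAddCommGroup E] [NormedSpace ℝ E] [NormedAddCommGroup F] [NormedSpace ℝ F]

theorem lintegral_sq_le {μ : Measure α} {f : α → ℝ≥0∞} (hf : AEMeasurable f μ) :
    (∫⁻ x, f x ∂μ) ^ 2 ≤ μ Set.univ * ∫⁻ x, f x ^ 2 ∂μ := by
  have h := ENNReal.lintegral_mul_le_Lp_mul_Lq μ Real.HolderConjugate.two_two
    aemeasurable_const (f := 1) hf
  simp only [Pi.mul_apply, Pi.one_apply, one_mul, ENNReal.one_rpow, lintegral_const] at h
  calc (∫⁻ x, f x ∂μ) ^ 2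
      ≤ (μ Set.univ ^ (1 / 2 : ℝ) * (∫⁻ x, f x ^ (2 : ℝ) ∂μ) ^ (1 / 2 : ℝ)) ^ 2 := by gcongr
    _ = μ Set.univ * ∫⁻ x, f x ^ 2 ∂μ := by
        simp only [mul_pow, ← ENNReal.rpow_natCast, ← ENNReal.rpow_mul]
        norm_num

theorem enorm_sub_sq_le_lintegral_deriv {v : ℝ → E} (hv : ContDiff ℝ 1 v) {a b p q : ℝ}
    (hp : p ∈ Set.Icc a b) (hq : q ∈ Set.Icc a b) :
    ‖v p - v q‖ₑ ^ 2 ≤ ENNReal.ofReal (b - a) * ∫⁻ t in Set.Ioo a b, ‖deriv v t‖ₑ ^ 2 := by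
  wlog hqp : q ≤ p generalizing p q
  · rw [← neg_sub, enorm_neg]
    exact this hq hp (le_of_not_ge hqp)
  have hsub : ‖v p - v q‖ₑ ≤ ∫⁻ t in Set.Ioo a b, ‖deriv v t‖ₑ :=
    calc ‖v p - v q‖ₑ ≤ ∫⁻ t in Set.Icc q p, ‖deriv v t‖ₑ :=
          enorm_sub_le_lintegral_deriv_of_contDiffOn_Icc hv.contDiffOn hqp
      _ ≤ ∫⁻ t in Set.Icc a b, ‖deriv v t‖ₑ := by gcongr; exacts [hq.1, hp.2]
      _ = ∫⁻ t in Set.Ioo a b, ‖deriv v t‖ₑ := by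
          rw [Measure.restrict_congr_set Ioo_ae_eq_Icc]
  calc ‖v p - v q‖ₑ ^ 2 ≤ (∫⁻ t in Set.Ioo a b, ‖deriv v t‖ₑ) ^ 2 := by gcongr
    _ ≤ ENNReal.ofReal (b - a) * ∫⁻ t in Set.Ioo a b, ‖deriv v t‖ₑ ^ 2 := by
        simpa using lintegral_sq_le (μ := volume.restrict (Set.Ioo a b))
          (hv.continuous_deriv le_rfl).enorm.measurable.aemeasurable

theorem enorm_sq_mul_le_lintegral_deriv {v : ℝ → E} (hv : ContDiff ℝ 1 v) {a b : ℝ} (hab : a ≤ b) :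
    ENNReal.ofReal (b - a) * ‖v b‖ₑ ^ 2 ≤ 2 * ((∫⁻ t in Set.Ioo a b, ‖v t‖ₑ ^ 2) +
      ENNReal.ofReal (b - a) ^ 2 * ∫⁻ t in Set.Ioo a b, ‖deriv v t‖ₑ ^ 2) := by
  set L := ENNReal.ofReal (b - a)
  set J := ∫⁻ t in Set.Ioo a b, ‖deriv v t‖ₑ ^ 2
  have hpoint : ∀ t ∈ Set.Ioo a b, ‖v b‖ₑ ^ 2 ≤ 2 * (‖v t‖ₑ ^ 2 + L * J) := fun t ht => by
    calc ‖v b‖ₑ ^ 2 = ‖v t + (v b - v t)‖ₑ ^ 2 := by rw [add_sub_cancel]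
      _ ≤ 2 * (‖v t‖ₑ ^ 2 + ‖v b - v t‖ₑ ^ 2) := enorm_add_sq_le _ _
      _ ≤ 2 * (‖v t‖ₑ ^ 2 + L * J) := by
          gcongr
          exact enorm_sub_sq_le_lintegral_deriv hv ⟨hab, le_rfl⟩ (Set.Ioo_subset_Icc_self ht)
  calc L * ‖v b‖ₑ ^ 2 = ∫⁻ _ in Set.Ioo a b, ‖v b‖ₑ ^ 2 := by
        rw [setLIntegral_const, Real.volume_Ioo, mul_comm]
    _ ≤ ∫⁻ t in Set.Ioo a b, 2 * (‖v t‖ₑ ^ 2 + L * J) := setLIntegral_mono' measurableSet_Ioo hpoint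
    _ = 2 * ((∫⁻ t in Set.Ioo a b, ‖v t‖ₑ ^ 2) + L ^ 2 * J) := by
        rw [lintegral_const_mul' _ _ (by finiteness), lintegral_add_right _ measurable_const,
          setLIntegral_const, Real.volume_Ioo]
        ring

theorem enorm_deriv_comp_le {w : F → E} (hw : Differentiable ℝ w) {γ : ℝ → F}
    (hγ : Differentiable ℝ γ) (hγ' : LipschitzWith 1 γ) (t : ℝ) :
    ‖deriv (w ∘ γ) t‖ₑ ≤ ‖fderiv ℝ w (γ t)‖ₑ := by
  rw [((hw (γ t)).hasFDerivAt.comp_hasDerivAt t (hγ t).hasDerivAt).deriv, enorm_le_iff_norm_le]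
  simpa using (fderiv ℝ w (γ t)).le_of_opNorm_le_of_le le_rfl (norm_deriv_le_of_lipschitz hγ')

theorem enorm_sub_sq_le_lintegral_fderiv {w : F → E} (hw : ContDiff ℝ 1 w) {γ : ℝ → F}
    (hγ : ContDiff ℝ 1 γ) (hγ' : LipschitzWith 1 γ) {a b p q : ℝ}
    (hp : p ∈ Set.Icc a b) (hq : q ∈ Set.Icc a b) :
    ‖w (γ p) - w (γ q)‖ₑ ^ 2 ≤
      ENNReal.ofReal (b - a) * ∫⁻ t in Set.Ioo a b, ‖fderiv ℝ w (γ t)‖ₑ ^ 2 := by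
  refine (enorm_sub_sq_le_lintegral_deriv (hw.comp hγ) hp hq).trans ?_
  gcongr with t
  exact enorm_deriv_comp_le (hw.differentiable one_ne_zero) (hγ.differentiable one_ne_zero) hγ' t

theorem mul_enorm_sq_le_lintegral_fderiv {w : F → E} (hw : ContDiff ℝ 1 w) {γ : ℝ → F}
    (hγ : ContDiff ℝ 1 γ) (hγ' : LipschitzWith 1 γ) {a b k l : ℝ} (hab : a ≤ b) (hk : k ≤ b - a)
    (hl : b - a ≤ l) :
    ENNReal.ofReal k * ‖w (γ b)‖ₑ ^ 2 ≤ ∫⁻ t in Set.Ioo a b,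
      2 * (‖w (γ t)‖ₑ ^ 2 + ENNReal.ofReal l ^ 2 * ‖fderiv ℝ w (γ t)‖ₑ ^ 2) := by
  have hmeas : Measurable fun t => ‖w (γ t)‖ₑ ^ 2 :=
    (hw.continuous.comp hγ.continuous).enorm.measurable.pow_const 2
  rw [lintegral_const_mul' _ _ (by finiteness), lintegral_add_left hmeas,
    lintegral_const_mul' _ _ (by finiteness)]
  calc ENNReal.ofReal k * ‖w (γ b)‖ₑ ^ 2 ≤ ENNReal.ofReal (b - a) * ‖w (γ b)‖ₑ ^ 2 := by gcongr
    _ ≤ 2 * ((∫⁻ t in Set.Ioo a b, ‖w (γ t)‖ₑ ^ 2) + ENNReal.ofReal (b - a) ^ 2 *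
          ∫⁻ t in Set.Ioo a b, ‖deriv (w ∘ γ) t‖ₑ ^ 2) :=
        enorm_sq_mul_le_lintegral_deriv (hw.comp hγ) hab
    _ ≤ 2 * ((∫⁻ t in Set.Ioo a b, ‖w (γ t)‖ₑ ^ 2) + ENNReal.ofReal l ^ 2 *
          ∫⁻ t in Set.Ioo a b, ‖fderiv ℝ w (γ t)‖ₑ ^ 2) := by
        gcongr with t
        exact enorm_deriv_comp_le (hw.differentiable one_ne_zero) (hγ.differentiable one_ne_zero)
          hγ' t

theorem lintegral_regionBetween {μ : Measure α} [SFinite μ] {f g : α → ℝ} (hf : Measurable f)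
    (hg : Measurable g) {s : Set α} (hs : MeasurableSet s) {φ : α × ℝ → ℝ≥0∞}
    (hφ : Measurable φ) :
    ∫⁻ p in regionBetween f g s, φ p ∂μ.prod volume =
      ∫⁻ x in s, (∫⁻ t in Set.Ioo (f x) (g x), φ (x, t)) ∂μ := by
  have hmeas := measurableSet_regionBetween hf hg hs
  rw [← lintegral_indicator hmeas, lintegral_prod _ (hφ.indicator hmeas).aemeasurable,
    ← lintegral_indicator hs]
  congr 1 with x
  by_cases hx : x ∈ s
  · rw [Set.indicator_of_mem hx, ← lintegral_indicator measurableSet_Ioo]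
    congr 1 with t
    simp [Set.indicator, regionBetween, hx]
  · simp [Set.indicator, regionBetween, hx]

theorem exists_mem_setLIntegral_le {μ : Measure α} {ν : Measure β} [SFinite μ] [SFinite ν]
    (s : Set α) {t : Set β} (ht : ν t ≠ 0) (ht' : ν t ≠ ⊤) {φ : α × β → ℝ≥0∞}
    (hφ : Measurable φ) :
    ∃ y ∈ t, ∫⁻ x in s, φ (x, y) ∂μ ≤ (ν t)⁻¹ * ∫⁻ p in s ×ˢ t, φ p ∂μ.prod ν := by
  obtain ⟨y, hy, hle⟩ := exists_le_setLAverage ht ht'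
    (hφ.lintegral_prod_left' (μ := μ.restrict s)).aemeasurable
  refine ⟨y, hy, hle.trans_eq ?_⟩
  rw [setLAverage_eq, ENNReal.div_eq_inv_mul, ← Measure.prod_restrict,
    lintegral_prod_symm _ hφ.aemeasurable]

variable {s₁ s₂ t₁ t₂ B : ℝ} {b : ℝ → ℝ}

theorem exists_forall_enorm_sub_sq_le (hs : s₁ < s₂) (ht : t₁ < t₂)
    (hb₁ : ∀ s ∈ Set.Ioo s₁ s₂, t₂ ≤ b s) {w : ℝ × ℝ → E} (hw : ContDiff ℝ 1 w) :
    ∃ m : E, ∀ s ∈ Set.Ioo s₁ s₂, ∀ t ∈ Set.Ioo t₁ (b s), ‖w (s, t) - m‖ₑ ^ 2 ≤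
      2 * (ENNReal.ofReal (b s - t₁) * (∫⁻ t in Set.Ioo t₁ (b s), ‖fderiv ℝ w (s, t)‖ₑ ^ 2) +
        ENNReal.ofReal (s₂ - s₁) * ((ENNReal.ofReal (t₂ - t₁))⁻¹ *
          ∫⁻ p in regionBetween (fun _ => t₁) b (Set.Ioo s₁ s₂), ‖fderiv ℝ w p‖ₑ ^ 2)) := by
  obtain ⟨t', ht', hrow⟩ := exists_mem_setLIntegral_le (μ := volume) (ν := volume)
    (Set.Ioo s₁ s₂) (t := Set.Ioo t₁ t₂) (by simpa using ht) (by simp)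
    ((hw.continuous_fderiv one_ne_zero).enorm.measurable.pow_const 2)
  rw [Real.volume_Ioo, ← Measure.volume_eq_prod] at hrow
  refine ⟨w ((s₁ + s₂) / 2, t'), fun s hs' t ht'' => ?_⟩
  have hvert := enorm_sub_sq_le_lintegral_fderiv hw (γ := fun t => (s, t))
    (by fun_prop) (LipschitzWith.prodMk_left s) (Set.Ioo_subset_Icc_self ht'')
    ⟨ht'.1.le, ht'.2.le.trans (hb₁ s hs')⟩
  have hhor := enorm_sub_sq_le_lintegral_fderiv hw (γ := fun s => (s, t'))
    (by fun_prop) (LipschitzWith.prodMk_right t') (Set.Ioo_subset_Icc_self hs')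
    (q := (s₁ + s₂) / 2) ⟨by linarith, by linarith⟩
  have hregion : Set.Ioo s₁ s₂ ×ˢ Set.Ioo t₁ t₂ ⊆ regionBetween (fun _ => t₁) b (Set.Ioo s₁ s₂) :=
    fun p hp => ⟨hp.1, hp.2.1, hp.2.2.trans_le (hb₁ _ hp.1)⟩
  rw [← sub_add_sub_cancel _ (w (s, t'))]
  refine (enorm_add_sq_le _ _).trans ?_
  gcongr
  refine hhor.trans ?_
  gcongr
  exact hrow.trans (by gcongr)

theorem poincare_regionBetween (hb : Measurable b) (hs : s₁ < s₂) (ht : t₁ < t₂)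
    (hb₁ : ∀ s ∈ Set.Ioo s₁ s₂, t₂ ≤ b s) (hb₂ : ∀ s ∈ Set.Ioo s₁ s₂, b s ≤ B) :
    ∃ C ≠ (⊤ : ℝ≥0∞), ∀ w : ℝ × ℝ → E, ContDiff ℝ 1 w → ∃ m : E,
      ∫⁻ p in regionBetween (fun _ => t₁) b (Set.Ioo s₁ s₂), ‖w p - m‖ₑ ^ 2 ≤
        C * ∫⁻ p in regionBetween (fun _ => t₁) b (Set.Ioo s₁ s₂), ‖fderiv ℝ w p‖ₑ ^ 2 := by
  set H := ENNReal.ofReal (B - t₁)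
  set S := ENNReal.ofReal (s₂ - s₁)
  set K := ENNReal.ofReal (t₂ - t₁)
  have hK : K⁻¹ ≠ ⊤ := ENNReal.inv_ne_top.2 (by simpa [K] using ht)
  refine ⟨2 * (H * H) + 2 * (S * S * (H * K⁻¹)), by finiteness, fun w hw => ?_⟩
  obtain ⟨m, hm⟩ := exists_forall_enorm_sub_sq_le hs ht hb₁ hw
  set D := ∫⁻ p in regionBetween (fun _ => t₁) b (Set.Ioo s₁ s₂), ‖fderiv ℝ w p‖ₑ ^ 2
  have hD : ∫⁻ s in Set.Ioo s₁ s₂, ∫⁻ t in Set.Ioo t₁ (b s), ‖fderiv ℝ w (s, t)‖ₑ ^ 2 = D :=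
    (lintegral_regionBetween measurable_const hb measurableSet_Ioo
      ((hw.continuous_fderiv one_ne_zero).enorm.measurable.pow_const 2)).symm
  have hlen : ∀ s ∈ Set.Ioo s₁ s₂, ENNReal.ofReal (b s - t₁) ≤ H := fun s hs' =>
    ENNReal.ofReal_le_ofReal (sub_le_sub_right (hb₂ s hs') t₁)
  refine ⟨m, ?_⟩
  calc ∫⁻ p in regionBetween (fun _ => t₁) b (Set.Ioo s₁ s₂), ‖w p - m‖ₑ ^ 2
      = ∫⁻ s in Set.Ioo s₁ s₂, ∫⁻ t in Set.Ioo t₁ (b s), ‖w (s, t) - m‖ₑ ^ 2 :=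
        lintegral_regionBetween measurable_const hb measurableSet_Ioo
          ((hw.continuous.sub continuous_const).enorm.measurable.pow_const 2)
    _ ≤ ∫⁻ s in Set.Ioo s₁ s₂, (2 * (H * H) * (∫⁻ t in Set.Ioo t₁ (b s),
          ‖fderiv ℝ w (s, t)‖ₑ ^ 2) + 2 * (S * (H * K⁻¹)) * D) := by
        refine setLIntegral_mono' measurableSet_Ioo fun s hs' => ?_
        refine (setLIntegral_mono' measurableSet_Ioo (hm s hs')).trans ?_
        rw [setLIntegral_const, Real.volume_Ioo]
        calc _ ≤ 2 * (H * (∫⁻ t in Set.Ioo t₁ (b s), ‖fderiv ℝ w (s, t)‖ₑ ^ 2) +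
              S * (K⁻¹ * D)) * H := by gcongr <;> exact hlen s hs'
          _ = _ := by ring
    _ = 2 * (H * H) * D + 2 * (S * S * (H * K⁻¹)) * D := by
        rw [lintegral_add_right _ measurable_const, lintegral_const_mul' _ _ (by finiteness), hD,
          setLIntegral_const, Real.volume_Ioo]
        ring
    _ = _ := by ring

theorem trace_regionBetween (hb : Measurable b) (ht : t₁ < t₂)
    (hb₁ : ∀ s ∈ Set.Ioo s₁ s₂, t₂ ≤ b s) (hb₂ : ∀ s ∈ Set.Ioo s₁ s₂, b s ≤ B) :
    ∃ C ≠ (⊤ : ℝ≥0∞), ∀ w : ℝ × ℝ → E, ContDiff ℝ 1 w →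
      ∫⁻ s in Set.Ioo s₁ s₂, ‖w (s, b s)‖ₑ ^ 2 ≤
        C * ((∫⁻ p in regionBetween (fun _ => t₁) b (Set.Ioo s₁ s₂), ‖w p‖ₑ ^ 2) +
          ∫⁻ p in regionBetween (fun _ => t₁) b (Set.Ioo s₁ s₂), ‖fderiv ℝ w p‖ₑ ^ 2) := by
  set H := ENNReal.ofReal (B - t₁)
  set K := ENNReal.ofReal (t₂ - t₁)
  have hK₀ : K ≠ 0 := by simpa [K] using ht
  have hK : K⁻¹ ≠ ⊤ := ENNReal.inv_ne_top.2 hK₀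
  refine ⟨K⁻¹ * (2 * (1 + H ^ 2)), by finiteness, fun w hw => ?_⟩
  set R := regionBetween (fun _ => t₁) b (Set.Ioo s₁ s₂)
  have hmeas : Measurable fun p => ‖w p‖ₑ ^ 2 := hw.continuous.enorm.measurable.pow_const 2
  have hpoint : ∀ s ∈ Set.Ioo s₁ s₂, K * ‖w (s, b s)‖ₑ ^ 2 ≤
      ∫⁻ t in Set.Ioo t₁ (b s), 2 * (‖w (s, t)‖ₑ ^ 2 + H ^ 2 * ‖fderiv ℝ w (s, t)‖ₑ ^ 2) :=
    fun s hs => mul_enorm_sq_le_lintegral_fderiv hw (γ := fun t => (s, t)) (by fun_prop)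
      (LipschitzWith.prodMk_left s) (ht.le.trans (hb₁ s hs)) (sub_le_sub_right (hb₁ s hs) t₁)
      (sub_le_sub_right (hb₂ s hs) t₁)
  calc ∫⁻ s in Set.Ioo s₁ s₂, ‖w (s, b s)‖ₑ ^ 2
      = K⁻¹ * ∫⁻ s in Set.Ioo s₁ s₂, K * ‖w (s, b s)‖ₑ ^ 2 := by
        rw [lintegral_const_mul' _ _ ENNReal.ofReal_ne_top,
          ENNReal.inv_mul_cancel_left hK₀ ENNReal.ofReal_ne_top]
    _ ≤ K⁻¹ * ∫⁻ p in R, 2 * (‖w p‖ₑ ^ 2 + H ^ 2 * ‖fderiv ℝ w p‖ₑ ^ 2) := by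
        rw [Measure.volume_eq_prod, lintegral_regionBetween measurable_const hb measurableSet_Ioo
          (by fun_prop)]
        refine mul_le_mul_right ?_ _
        exact setLIntegral_mono' measurableSet_Ioo hpoint
    _ = K⁻¹ * (2 * ((∫⁻ p in R, ‖w p‖ₑ ^ 2) + H ^ 2 * ∫⁻ p in R, ‖fderiv ℝ w p‖ₑ ^ 2)) := by
        rw [lintegral_const_mul' _ _ (by finiteness), lintegral_add_left hmeas,
          lintegral_const_mul' _ _ (by finiteness)]
    _ ≤ K⁻¹ * (2 * (1 + H ^ 2)) * ((∫⁻ p in R, ‖w p‖ₑ ^ 2) + ∫⁻ p in R, ‖fderiv ℝ w p‖ₑ ^ 2) := by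
        rw [mul_assoc, mul_assoc, add_mul, one_mul]
        gcongr
        · exact le_self_add
        · exact le_add_self

end RegionBetween

/-! ### Local charts of a Lipschitz domain -/

section LocalCharts

/-- The linear coordinates `x ↦ ((e x) 0, (e x) 1)` in which a Lipschitz boundary is a graph. -/
def coords (e : Plane ≃ₗᵢ[ℝ] Plane) : Plane ≃L[ℝ] ℝ × ℝ :=
  (e.toContinuousLinearEquiv.trans (EuclideanSpace.equiv (Fin 2) ℝ)).trans
    (ContinuousLinearEquiv.finTwoArrow ℝ ℝ)

theorem measurePreserving_coords (e : Plane ≃ₗᵢ[ℝ] Plane) : MeasurePreserving (coords e) :=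
  (volume_preserving_finTwoArrow ℝ).comp
    ((PiLp.volume_preserving_ofLp (Fin 2)).comp e.measurePreserving)

/-- Measure-preserving linear coordinates on `U` in which `U ∩ Ω` is the region below the graph of a
Lipschitz function over an interval, and the part of `∂Ω` in `U` lies on this graph. The graph stays
between the heights `t₂` and `B`, and the bottom of the region is at the height `t₁ < t₂`. -/
structure LocalChart (Ω U : Set Plane) where
  coords : Plane ≃L[ℝ] ℝ × ℝ
  measurePreserving : MeasurePreserving coords
  s₁ : ℝ
  s₂ : ℝ
  t₁ : ℝ
  t₂ : ℝ
  B : ℝ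
  b : ℝ → ℝ
  K : ℝ≥0
  lipschitz : LipschitzWith K b
  s_lt : s₁ < s₂
  t_lt : t₁ < t₂
  le_b : ∀ s ∈ Set.Ioo s₁ s₂, t₂ ≤ b s
  b_le : ∀ s ∈ Set.Ioo s₁ s₂, b s ≤ B
  inter_eq : U ∩ Ω = coords ⁻¹' regionBetween (fun _ => t₁) b (Set.Ioo s₁ s₂)
  inter_frontier_subset : U ∩ frontier Ω ⊆ (fun s => coords.symm (s, b s)) '' Set.Ioo s₁ s₂

theorem le_of_mem_closure_of_eventually {X : Type*} [TopologicalSpace X] {S : Set X} {f g : X → ℝ}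
    (hf : Continuous f) (hg : Continuous g) {x : X} (hx : x ∈ closure S)
    (h : ∀ᶠ y in 𝓝 x, y ∈ S → f y ≤ g y) : f x ≤ g x :=
  (isClosed_le hf hg).closure_subset <| mem_closure_iff_frequently.2 <|
    (mem_closure_iff_frequently.1 hx).mp h

theorem eq_of_mem_frontier_of_eventually {X : Type*} [TopologicalSpace X] {S : Set X}
    {f g : X → ℝ} (hf : Continuous f) (hg : Continuous g) {x : X} (hx : x ∈ frontier S)
    (h : ∀ᶠ y in 𝓝 x, y ∈ S ↔ f y < g y) : f x = g x := by
  rw [frontier_eq_closure_inter_closure] at hx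
  refine le_antisymm (le_of_mem_closure_of_eventually hf hg hx.1 ?_)
    (le_of_mem_closure_of_eventually hg hf hx.2 ?_)
  · filter_upwards [h] with y hy hyS using (hy.1 hyS).le
  · filter_upwards [h] with y hy hyS using not_lt.1 (mt hy.2 hyS)

theorem HasLipschitzBoundary.eventually_mem_iff {Ω : Set Plane} (hΩ : HasLipschitzBoundary Ω)
    (ho : IsOpen Ω) {p : Plane} (hp : p ∈ closure Ω) :
    ∃ (e : Plane ≃ₗᵢ[ℝ] Plane) (K : ℝ≥0) (φ : ℝ → ℝ), LipschitzWith K φ ∧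
      ∀ᶠ x in 𝓝 p, x ∈ Ω ↔ (coords e x).2 < φ (coords e x).1 := by
  by_cases hpΩ : p ∈ Ω
  · refine ⟨LinearIsometryEquiv.refl ℝ Plane, 0, fun _ => p 1 + 1, LipschitzWith.const _, ?_⟩
    have hbelow : ∀ᶠ x : Plane in 𝓝 p, x 1 < p 1 + 1 :=
      (EuclideanSpace.proj (𝕜 := ℝ) (1 : Fin 2)).continuous.continuousAt.eventually_lt_const
        (lt_add_one (p 1))
    filter_upwards [ho.mem_nhds hpΩ, hbelow] with x hx hx' using iff_of_true hx hx'
  · obtain ⟨e, K, φ, r, hφ, hr, h⟩ := hΩ p (ho.frontier_eq ▸ ⟨hp, hpΩ⟩)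
    exact ⟨e, K, φ, hφ, eventually_of_mem (Metric.ball_mem_nhds p hr) h⟩

/-- The chart on a box of half-widths `δ` and `ρ`, with `K δ < ρ`, around a point `(s₀, t₀)` on or
below a `K`-Lipschitz graph. The graph is cut off at the top of the box. -/
def LocalChart.ofGraph {Ω : Set Plane} (A : Plane ≃L[ℝ] ℝ × ℝ) (hA : MeasurePreserving A)
    {K : ℝ≥0} {φ : ℝ → ℝ} (hφ : LipschitzWith K φ) {s₀ t₀ δ ρ : ℝ} (h₀ : t₀ ≤ φ s₀) (hδ : 0 < δ)
    (hρ : K * δ < ρ)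
    (hmem : ∀ x, A x ∈ Set.Ioo (s₀ - δ) (s₀ + δ) ×ˢ Set.Ioo (t₀ - ρ) (t₀ + ρ) →
      ∀ᶠ y in 𝓝 x, y ∈ Ω ↔ (A y).2 < φ (A y).1) :
    LocalChart Ω (A ⁻¹' Set.Ioo (s₀ - δ) (s₀ + δ) ×ˢ Set.Ioo (t₀ - ρ) (t₀ + ρ)) where
  coords := A
  measurePreserving := hA
  s₁ := s₀ - δ
  s₂ := s₀ + δ
  t₁ := t₀ - ρ
  t₂ := t₀ - K * δ
  B := t₀ + ρ
  b s := min (φ s) (t₀ + ρ)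
  K := K
  lipschitz := hφ.min_const _
  s_lt := by linarith
  t_lt := by linarith
  le_b s hs := by
    have hKδ : 0 ≤ K * δ := mul_nonneg K.2 hδ.le
    have hdist : |s₀ - s| ≤ δ := abs_sub_le_iff.2 ⟨by linarith [hs.1], by linarith [hs.2]⟩
    have hosc : φ s₀ - φ s ≤ K * δ := (le_abs_self _).trans <| (hφ.dist_le_mul s₀ s).trans <|
      mul_le_mul_of_nonneg_left hdist K.2
    exact le_min (by linarith) (by linarith)
  b_le _ _ := min_le_right _ _
  inter_eq := by
    ext x
    have hiff := fun hx => (hmem x hx).self_of_nhds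
    simp only [Set.mem_inter_iff, Set.mem_preimage, regionBetween, Set.mem_ofPred_eq,
      Set.mem_prod, Set.mem_Ioo, lt_min_iff] at hiff ⊢
    tauto
  inter_frontier_subset := by
    rintro x ⟨hx, hxΩ⟩
    have hgraph : (A x).2 = φ (A x).1 :=
      eq_of_mem_frontier_of_eventually (continuous_snd.comp A.continuous)
        (hφ.continuous.comp (continuous_fst.comp A.continuous)) hxΩ (hmem x hx)
    refine ⟨(A x).1, hx.1, ?_⟩
    change A.symm (_, min (φ (A x).1) (t₀ + ρ)) = x
    rw [min_eq_left (hgraph ▸ hx.2.2.le), ← hgraph, Prod.mk.eta, A.symm_apply_apply]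

theorem HasLipschitzBoundary.exists_localChart {Ω : Set Plane} (hΩ : HasLipschitzBoundary Ω)
    (ho : IsOpen Ω) {p : Plane} (hp : p ∈ closure Ω) :
    ∃ U, IsOpen U ∧ p ∈ U ∧ Nonempty (LocalChart Ω U) := by
  obtain ⟨e, K, φ, hφ, hmem⟩ := hΩ.eventually_mem_iff ho hp
  have hp_le : (coords e p).2 ≤ φ (coords e p).1 :=
    le_of_mem_closure_of_eventually (continuous_snd.comp (coords e).continuous)
      (hφ.continuous.comp (continuous_fst.comp (coords e).continuous)) hp
      (hmem.mono fun x hx hxΩ => (hx.1 hxΩ).le)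
  have hcoords : ∀ᶠ q in 𝓝 (coords e p),
      ∀ᶠ x in 𝓝 ((coords e).symm q), x ∈ Ω ↔ (coords e x).2 < φ (coords e x).1 :=
    (coords e).symm.continuous.continuousAt.eventually
      ((coords e).symm_apply_apply p ▸ hmem.eventually_nhds)
  obtain ⟨ρ, hρ, hball⟩ := Metric.eventually_nhds_iff_ball.1 hcoords
  rw [← Prod.mk.eta (p := coords e p), ← ball_prod_same, Real.ball_eq_Ioo,
    Real.ball_eq_Ioo] at hball
  have hK : (0 : ℝ) ≤ K := K.2
  have hδ : 0 < ρ / (K + 1) := by positivity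
  have hδρ : K * (ρ / (K + 1)) + ρ / (K + 1) = ρ := by field_simp
  have hδ_le : ρ / (K + 1) ≤ ρ := by linarith [mul_nonneg hK hδ.le]
  refine ⟨_, (isOpen_Ioo.prod isOpen_Ioo).preimage (coords e).continuous, ?_,
    ⟨LocalChart.ofGraph (coords e) (measurePreserving_coords e) hφ hp_le hδ
      (lt_of_lt_of_eq (lt_add_of_pos_right _ hδ) hδρ) fun x hx => ?_⟩⟩
  · exact ⟨⟨by linarith, by linarith⟩, by linarith, by linarith⟩
  · simpa only [ContinuousLinearEquiv.symm_apply_apply] using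
      hball (coords e x) ⟨Set.Ioo_subset_Ioo (by linarith) (by linarith) hx.1, hx.2⟩

namespace LocalChart

variable {Ω U : Set Plane} {E : Type*} [NormedAddCommGroup E] [NormedSpace ℝ E]

theorem setLIntegral_inter (c : LocalChart Ω U) (F : Plane → ℝ≥0∞) :
    ∫⁻ x in U ∩ Ω, F x =
      ∫⁻ p in regionBetween (fun _ => c.t₁) c.b (Set.Ioo c.s₁ c.s₂), F (c.coords.symm p) := by
  rw [c.inter_eq, ← c.measurePreserving.setLIntegral_comp_preimage_emb
    c.coords.toHomeomorph.measurableEmbedding]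
  simp only [ContinuousLinearEquiv.symm_apply_apply]

theorem setLIntegral_fderiv_comp_symm_le (c : LocalChart Ω U) (u : Plane → E) :
    ∫⁻ p in regionBetween (fun _ => c.t₁) c.b (Set.Ioo c.s₁ c.s₂),
        ‖fderiv ℝ (u ∘ c.coords.symm) p‖ₑ ^ 2 ≤
      ‖(c.coords.symm : ℝ × ℝ →L[ℝ] Plane)‖ₑ ^ 2 * ∫⁻ x in U ∩ Ω, ‖fderiv ℝ u x‖ₑ ^ 2 := by
  rw [c.setLIntegral_inter, ← lintegral_const_mul' _ _ (by finiteness)]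
  refine lintegral_mono fun p => ?_
  rw [ContinuousLinearEquiv.comp_right_fderiv, ← mul_pow, mul_comm]
  gcongr
  exact ContinuousLinearMap.opENorm_comp_le _ _

theorem poincare (c : LocalChart Ω U) :
    ∃ C ≠ (⊤ : ℝ≥0∞), ∀ u : Plane → E, ContDiff ℝ 1 u → ∃ m : E,
      ∫⁻ x in U ∩ Ω, ‖u x - m‖ₑ ^ 2 ≤ C * ∫⁻ x in U ∩ Ω, ‖fderiv ℝ u x‖ₑ ^ 2 := by
  obtain ⟨C, hC, h⟩ := poincare_regionBetween (E := E) c.lipschitz.continuous.measurable c.s_lt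
    c.t_lt c.le_b c.b_le
  refine ⟨C * ‖(c.coords.symm : ℝ × ℝ →L[ℝ] Plane)‖ₑ ^ 2, by finiteness, fun u hu => ?_⟩
  obtain ⟨m, hm⟩ := h (u ∘ c.coords.symm) (hu.comp c.coords.symm.contDiff)
  refine ⟨m, ?_⟩
  rw [c.setLIntegral_inter, mul_assoc]
  refine hm.trans ?_
  gcongr
  exact c.setLIntegral_fderiv_comp_symm_le u

/-- The parametrization of the graph that contains the boundary. -/
def graphMap (c : LocalChart Ω U) (s : ℝ) : Plane := c.coords.symm (s, c.b s)

theorem continuous_graphMap (c : LocalChart Ω U) : Continuous c.graphMap :=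
  c.coords.symm.continuous.comp (continuous_id.prodMk c.lipschitz.continuous)

theorem exists_hausdorffMeasure_restrict_le (c : LocalChart Ω U) :
    ∃ L : ℝ≥0, (μH[1] : Measure Plane).restrict (U ∩ frontier Ω) ≤
      (L : ℝ≥0∞) • (volume.restrict (Set.Ioo c.s₁ c.s₂)).map c.graphMap := by
  have hlip : LipschitzWith (‖(c.coords.symm : ℝ × ℝ →L[ℝ] Plane)‖₊ * max 1 c.K) c.graphMap :=
    (c.coords.symm : ℝ × ℝ →L[ℝ] Plane).lipschitz.comp (LipschitzWith.id.prodMk c.lipschitz)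
  refine ⟨‖(c.coords.symm : ℝ × ℝ →L[ℝ] Plane)‖₊ * max 1 c.K, Measure.le_iff.2 fun T hT => ?_⟩
  rw [Measure.restrict_apply hT, Measure.smul_apply, smul_eq_mul,
    Measure.map_apply c.continuous_graphMap.measurable hT,
    Measure.restrict_apply (c.continuous_graphMap.measurable hT)]
  calc
    _ ≤ μH[1] (c.graphMap '' (c.graphMap ⁻¹' T ∩ Set.Ioo c.s₁ c.s₂)) := by
      rw [Set.image_preimage_inter]
      gcongr
      exact c.inter_frontier_subset
    _ ≤ _ := by
      simpa only [ENNReal.rpow_one, hausdorffMeasure_real] using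
        hlip.hausdorffMeasure_image_le zero_le_one (c.graphMap ⁻¹' T ∩ Set.Ioo c.s₁ c.s₂)

theorem trace (c : LocalChart Ω U) :
    ∃ C ≠ (⊤ : ℝ≥0∞), ∀ u : Plane → E, ContDiff ℝ 1 u →
      ∫⁻ x in U ∩ frontier Ω, ‖u x‖ₑ ^ 2 ∂μH[1] ≤
        C * ((∫⁻ x in U ∩ Ω, ‖u x‖ₑ ^ 2) + ∫⁻ x in U ∩ Ω, ‖fderiv ℝ u x‖ₑ ^ 2) := by
  obtain ⟨C, hC, h⟩ := trace_regionBetween (E := E) c.lipschitz.continuous.measurable c.t_lt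
    c.le_b c.b_le
  obtain ⟨L, hL⟩ := c.exists_hausdorffMeasure_restrict_le
  refine ⟨L * (C * (1 + ‖(c.coords.symm : ℝ × ℝ →L[ℝ] Plane)‖ₑ ^ 2)), by finiteness,
    fun u hu => ?_⟩
  have hu' : ContDiff ℝ 1 (u ∘ c.coords.symm) := hu.comp c.coords.symm.contDiff
  calc
    _ ≤ L * ∫⁻ s in Set.Ioo c.s₁ c.s₂, ‖u (c.graphMap s)‖ₑ ^ 2 := by
      refine (lintegral_mono' hL le_rfl).trans_eq ?_
      rw [lintegral_smul_measure, smul_eq_mul,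
        lintegral_map (hu.continuous.enorm.measurable.pow_const 2) c.continuous_graphMap.measurable]
    _ ≤ L * (C * ((∫⁻ x in U ∩ Ω, ‖u x‖ₑ ^ 2) + ‖(c.coords.symm : ℝ × ℝ →L[ℝ] Plane)‖ₑ ^ 2 *
        ∫⁻ x in U ∩ Ω, ‖fderiv ℝ u x‖ₑ ^ 2)) := by
      rw [c.setLIntegral_inter fun x => ‖u x‖ₑ ^ 2]
      gcongr
      refine (h _ hu').trans ?_
      gcongr _ * ?_
      exact add_le_add le_rfl (c.setLIntegral_fderiv_comp_symm_le u)
    _ ≤ _ := by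
      rw [mul_assoc, mul_assoc]
      gcongr _ * (_ * ?_)
      rw [add_mul, one_mul]
      gcongr ?_ + ?_
      · exact le_self_add
      · gcongr
        exact le_add_self

end LocalChart

end LocalCharts

/-! ### Poincaré and trace inequalities on a Lipschitz domain -/

section DomainInequalities

theorem exists_superset_of_isConnected {X : Type*} [TopologicalSpace X] {Ω : Set X}
    {P : Set X → Prop} (hc : IsConnected Ω) (hK : IsCompact (closure Ω))
    (hloc : ∀ p ∈ closure Ω, ∃ U, IsOpen U ∧ p ∈ U ∧ P (U ∩ Ω))
    (hunion : ∀ S T, P S → P T → (S ∩ T).Nonempty → P (S ∪ T)) : ∃ S, P S ∧ Ω ⊆ S := by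
  obtain ⟨x₀, hx₀⟩ := hc.nonempty
  have hjoin : ∀ y ∈ Ω, ∃ S, P S ∧ x₀ ∈ S ∧ y ∈ S := fun y hy => by
    refine hc.isPreconnected.induction₂ (fun x y => ∃ S, P S ∧ x ∈ S ∧ y ∈ S) (fun x hx => ?_)
      ?_ (fun _ _ _ _ ⟨S, hS, hx, hy⟩ => ⟨S, hS, hy, hx⟩) hx₀ hy
    · obtain ⟨U, hU, hxU, hPU⟩ := hloc x (subset_closure hx)
      filter_upwards [mem_nhdsWithin_of_mem_nhds (hU.mem_nhds hxU), self_mem_nhdsWithin]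
        with y hyU hyΩ using ⟨_, hPU, ⟨hxU, hx⟩, hyU, hyΩ⟩
    · rintro x y z - - - ⟨S, hS, hxS, hyS⟩ ⟨T, hT, hyT, hzT⟩
      exact ⟨S ∪ T, hunion S T hS hT ⟨y, hyS, hyT⟩, .inl hxS, .inr hzT⟩
  obtain ⟨S, hS, -, hΩS⟩ := hK.induction_on (p := fun A => ∃ S, P S ∧ x₀ ∈ S ∧ A ∩ Ω ⊆ S)
    (by simpa using hjoin x₀ hx₀)
    (fun A B hAB ⟨S, hS, hx, hBS⟩ => ⟨S, hS, hx, (Set.inter_subset_inter_left Ω hAB).trans hBS⟩)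
    (fun A B ⟨S, hS, hxS, hAS⟩ ⟨T, hT, hxT, hBT⟩ =>
      ⟨S ∪ T, hunion S T hS hT ⟨x₀, hxS, hxT⟩, .inl hxS,
        (Set.union_inter_distrib_right A B Ω).trans_subset (Set.union_subset_union hAS hBT)⟩)
    (fun p hp => by
      obtain ⟨U, hU, hpU, hPU⟩ := hloc p hp
      obtain ⟨y, hyU, hyΩ⟩ := mem_closure_iff.1 hp U hU hpU
      obtain ⟨T, hT, hxT, hyT⟩ := hjoin y hyΩ
      exact ⟨U, mem_nhdsWithin_of_mem_nhds (hU.mem_nhds hpU), T ∪ U ∩ Ω,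
        hunion T _ hT hPU ⟨y, hyT, hyU, hyΩ⟩, .inl hxT, Set.subset_union_right⟩)
  exact ⟨S, hS, fun x hx => hΩS ⟨subset_closure hx, hx⟩⟩

section TwoConstants

variable {X E : Type*} [MeasurableSpace X] {μ : Measure X} [NormedAddCommGroup E]

theorem lintegral_enorm_sub_sq_le (f : X → E) (m m' : E) :
    ∫⁻ x, ‖f x - m‖ₑ ^ 2 ∂μ ≤
      2 * (∫⁻ x, ‖f x - m'‖ₑ ^ 2 ∂μ + ‖m' - m‖ₑ ^ 2 * μ Set.univ) := by
  rw [← lintegral_const, ← lintegral_add_right _ measurable_const,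
    ← lintegral_const_mul' _ _ ENNReal.ofNat_ne_top]
  gcongr with x
  simpa only [sub_add_sub_cancel] using enorm_add_sq_le (f x - m') (m' - m)

theorem enorm_sub_sq_mul_measure_le {f : X → E} (hf : AEStronglyMeasurable f μ) (m m' : E) :
    ‖m' - m‖ₑ ^ 2 * μ Set.univ ≤
      2 * (∫⁻ x, ‖f x - m'‖ₑ ^ 2 ∂μ + ∫⁻ x, ‖f x - m‖ₑ ^ 2 ∂μ) := by
  have hfm : AEMeasurable (fun x => ‖f x - m‖ₑ ^ 2) μ :=
    (hf.sub aestronglyMeasurable_const).enorm.pow_const 2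
  rw [← lintegral_const, ← lintegral_add_right' _ hfm,
    ← lintegral_const_mul' _ _ ENNReal.ofNat_ne_top]
  gcongr with x
  simpa only [enorm_sub_rev m', sub_add_sub_cancel] using enorm_add_sq_le (m' - f x) (f x - m)

end TwoConstants

/-- The Poincaré inequality on `S` for continuously differentiable functions on the whole space with
values in `E`. -/
def PoincareOn {X : Type*} [NormedAddCommGroup X] [NormedSpace ℝ X] [MeasurableSpace X]
    (μ : Measure X) (E : Type*) [NormedAddCommGroup E] [NormedSpace ℝ E] (S : Set X) : Prop :=
  ∃ C ≠ (⊤ : ℝ≥0∞), ∀ u : X → E, ContDiff ℝ 1 u → ∃ m : E,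
    ∫⁻ x in S, ‖u x - m‖ₑ ^ 2 ∂μ ≤ C * ∫⁻ x in S, ‖fderiv ℝ u x‖ₑ ^ 2 ∂μ

theorem PoincareOn.union {X E : Type*} [NormedAddCommGroup X] [NormedSpace ℝ X] [MeasurableSpace X]
    [OpensMeasurableSpace X] [SecondCountableTopology X] {μ : Measure X} [NormedAddCommGroup E]
    [NormedSpace ℝ E] {S T : Set X} (hS : PoincareOn μ E S) (hT : PoincareOn μ E T)
    (h₀ : μ (S ∩ T) ≠ 0) (hμT : μ T ≠ ⊤) : PoincareOn μ E (S ∪ T) := by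
  obtain ⟨C, hC, hS⟩ := hS
  obtain ⟨C', hC', hT⟩ := hT
  have hV : (μ (S ∩ T))⁻¹ ≠ ⊤ := ENNReal.inv_ne_top.2 h₀
  refine ⟨C + 2 * (C' + (μ (S ∩ T))⁻¹ * (2 * (C' + C)) * μ T), by finiteness, fun u hu => ?_⟩
  obtain ⟨m, hm⟩ := hS u hu
  obtain ⟨m', hm'⟩ := hT u hu
  refine ⟨m, ?_⟩
  set G := ∫⁻ x in S ∪ T, ‖fderiv ℝ u x‖ₑ ^ 2 ∂μ
  have hmG : ∫⁻ x in S, ‖u x - m‖ₑ ^ 2 ∂μ ≤ C * G :=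
    hm.trans (by gcongr; exact lintegral_mono_set Set.subset_union_left)
  have hmG' : ∫⁻ x in T, ‖u x - m'‖ₑ ^ 2 ∂μ ≤ C' * G :=
    hm'.trans (by gcongr; exact lintegral_mono_set Set.subset_union_right)
  have hdiff : ‖m' - m‖ₑ ^ 2 ≤ (μ (S ∩ T))⁻¹ * (2 * (C' * G + C * G)) := by
    rw [mul_comm _ (2 * _), ← div_eq_mul_inv, ENNReal.le_div_iff_mul_le (.inl h₀)
      (.inl (measure_ne_top_of_subset Set.inter_subset_right hμT))]
    have h := enorm_sub_sq_mul_measure_le (μ := μ.restrict (S ∩ T))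
      hu.continuous.aestronglyMeasurable m m'
    rw [Measure.restrict_apply_univ] at h
    refine h.trans ?_
    gcongr
    · exact (lintegral_mono_set Set.inter_subset_right).trans hmG'
    · exact (lintegral_mono_set Set.inter_subset_left).trans hmG
  calc ∫⁻ x in S ∪ T, ‖u x - m‖ₑ ^ 2 ∂μ
      ≤ ∫⁻ x in S, ‖u x - m‖ₑ ^ 2 ∂μ + ∫⁻ x in T, ‖u x - m‖ₑ ^ 2 ∂μ := lintegral_union_le _ _ _
    _ ≤ C * G + 2 * (C' * G + (μ (S ∩ T))⁻¹ * (2 * (C' * G + C * G)) * μ T) := by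
      refine add_le_add hmG ((lintegral_enorm_sub_sq_le u m m').trans ?_)
      rw [Measure.restrict_apply_univ]
      gcongr
    _ = _ := by ring

variable {Ω : Set Plane} {E : Type*} [NormedAddCommGroup E] [NormedSpace ℝ E]

variable (E) in
theorem HasLipschitzBoundary.poincareOn (hl : HasLipschitzBoundary Ω) (ho : IsOpen Ω)
    (hc : IsConnected Ω) (hb : Bornology.IsBounded Ω) : PoincareOn volume E Ω := by
  obtain ⟨S, ⟨-, hSΩ, hS⟩, hΩS⟩ := exists_superset_of_isConnected
    (P := fun S => IsOpen S ∧ S ⊆ Ω ∧ PoincareOn volume E S) hc hb.isCompact_closure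
    (fun p hp => by
      obtain ⟨U, hU, hpU, ⟨c⟩⟩ := hl.exists_localChart ho hp
      exact ⟨U, hU, hpU, hU.inter ho, Set.inter_subset_right, c.poincare⟩)
    (fun S T ⟨hSo, hSΩ, hS⟩ ⟨hTo, hTΩ, hT⟩ hST => ⟨hSo.union hTo, Set.union_subset hSΩ hTΩ,
      hS.union hT ((hSo.inter hTo).measure_pos volume hST).ne'
        (measure_ne_top_of_subset hTΩ hb.measure_lt_top.ne)⟩)
  rwa [hSΩ.antisymm hΩS] at hS

variable (E) in
theorem HasLipschitzBoundary.trace (hl : HasLipschitzBoundary Ω) (ho : IsOpen Ω)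
    (hb : Bornology.IsBounded Ω) :
    ∃ C ≠ (⊤ : ℝ≥0∞), ∀ u : Plane → E, ContDiff ℝ 1 u →
      ∫⁻ x, ‖u x‖ₑ ^ 2 ∂bdryMeasure Ω ≤
        C * ((∫⁻ x in Ω, ‖u x‖ₑ ^ 2) + ∫⁻ x in Ω, ‖fderiv ℝ u x‖ₑ ^ 2) := by
  have hK : IsCompact (frontier Ω) :=
    hb.isCompact_closure.of_isClosed_subset isClosed_frontier frontier_subset_closure
  refine hK.induction_on (p := fun S => ∃ C ≠ (⊤ : ℝ≥0∞), ∀ u : Plane → E, ContDiff ℝ 1 u →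
      ∫⁻ x in S, ‖u x‖ₑ ^ 2 ∂μH[1] ≤
        C * ((∫⁻ x in Ω, ‖u x‖ₑ ^ 2) + ∫⁻ x in Ω, ‖fderiv ℝ u x‖ₑ ^ 2)) ?_ ?_ ?_ ?_
  · exact ⟨0, ENNReal.zero_ne_top, fun u _ => by simp⟩
  · rintro S T hST ⟨C, hC, h⟩
    exact ⟨C, hC, fun u hu => (lintegral_mono_set hST).trans (h u hu)⟩
  · rintro S T ⟨C, hC, h⟩ ⟨C', hC', h'⟩
    refine ⟨C + C', by finiteness, fun u hu => (lintegral_union_le _ _ _).trans ?_⟩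
    rw [add_mul]
    exact add_le_add (h u hu) (h' u hu)
  · intro p hp
    obtain ⟨U, hU, hpU, ⟨c⟩⟩ := hl.exists_localChart ho (frontier_subset_closure hp)
    obtain ⟨C, hC, h⟩ := c.trace (E := E)
    refine ⟨U ∩ frontier Ω, Set.inter_comm U _ ▸ inter_mem_nhdsWithin _ (hU.mem_nhds hpU),
      C, hC, fun u hu => (h u hu).trans ?_⟩
    gcongr <;> exact Set.inter_subset_right

end DomainInequalities

/-! ### Gradients -/

section Gradient

variable {F : Type*} [NormedAddCommGroup F] [InnerProductSpace ℝ F] [CompleteSpace F]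
  {u v φ : F → ℝ} {x : F}

theorem gradient_add (hu : DifferentiableAt ℝ u x) (hv : DifferentiableAt ℝ v x) :
    gradient (u + v) x = gradient u x + gradient v x := by
  simp only [gradient, fderiv_add hu hv, map_add]

theorem gradient_const_smul (hu : DifferentiableAt ℝ u x) (k : ℝ) :
    gradient (k • u) x = k • gradient u x := by
  simp only [gradient, fderiv_const_smul hu, map_smulₛₗ, conj_trivial]

theorem enorm_gradient (u : F → ℝ) (x : F) : ‖gradient u x‖ₑ = ‖fderiv ℝ u x‖ₑ := by
  rw [gradient, LinearIsometryEquiv.enorm_map]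

theorem continuous_gradient (hu : ContDiff ℝ 1 u) : Continuous (gradient u) :=
  (InnerProductSpace.toDual ℝ F).symm.continuous.comp (hu.continuous_fderiv one_ne_zero)

theorem setIntegral_mul_fderiv_eq_neg_inner_gradient [MeasurableSpace F] [BorelSpace F]
    [FiniteDimensional ℝ F] {μ : Measure F} [μ.IsAddHaarMeasure] {Ω : Set F}
    (hu : ContDiff ℝ 1 u) (hφ : ContDiff ℝ 1 φ) (hc : HasCompactSupport φ)
    (hs : tsupport φ ⊆ Ω) (e : F) :
    ∫ x in Ω, u x * fderiv ℝ φ x e ∂μ = - ∫ x in Ω, inner ℝ (gradient u x) e * φ x ∂μ := by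
  have hφ_zero : ∀ x ∉ Ω, φ x = 0 := fun x hx =>
    image_eq_zero_of_notMem_tsupport fun h => hx (hs h)
  have hφ'_zero : ∀ x ∉ Ω, fderiv ℝ φ x = 0 := fun x hx =>
    Function.notMem_support.1 fun h => hx (hs (support_fderiv_subset ℝ h))
  have hu' := (hu.continuous_fderiv one_ne_zero).clm_apply (continuous_const (y := e))
  have hφ' := (hφ.continuous_fderiv one_ne_zero).clm_apply (continuous_const (y := e))
  rw [setIntegral_eq_integral_of_forall_compl_eq_zero fun x hx => by simp [hφ'_zero x hx],
    setIntegral_eq_integral_of_forall_compl_eq_zero fun x hx => by simp [hφ_zero x hx]]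
  simp_rw [inner_gradient_left]
  exact integral_mul_fderiv_eq_neg_fderiv_mul_of_integrable
    ((hu'.mul hφ.continuous).integrable_of_hasCompactSupport hc.mul_left)
    ((hu.continuous.mul hφ').integrable_of_hasCompactSupport (hc.fderiv_apply ℝ e).mul_left)
    ((hu.continuous.mul hφ.continuous).integrable_of_hasCompactSupport hc.mul_left)
    (fun x _ => (hu.differentiable one_ne_zero).differentiableAt)
    (fun x _ => (hφ.differentiable one_ne_zero).differentiableAt)

end Gradient

theorem IsWeakGradient.ae_eq {Ω : Set Plane} (ho : IsOpen Ω) {u : Plane → ℝ} {G G' : Plane → Plane}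
    (h : IsWeakGradient Ω u G) (h' : IsWeakGradient Ω u G') : G =ᵐ[volume.restrict Ω] G' := by
  have hG : MemLp (G - G') 2 (volume.restrict Ω) := h.memLp_grad.sub h'.memLp_grad
  have htest : ∀ φ : Plane → ℝ, ContDiff ℝ ∞ φ → HasCompactSupport φ → tsupport φ ⊆ Ω →
      ∫ x, φ x • (G - G') x = 0 := fun φ hφ hc hs => by
    have hφ2 : MemLp φ 2 (volume.restrict Ω) :=
      (hφ.continuous.memLp_of_hasCompactSupport hc).restrict Ω
    have hint : ∀ {H : Plane → Plane}, MemLp H 2 (volume.restrict Ω) →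
        ∀ e, Integrable (fun x => inner ℝ (H x) e * φ x) (volume.restrict Ω) :=
      fun hH e => (hH.inner_const e).integrable_mul hφ2
    rw [← setIntegral_eq_integral_of_forall_compl_eq_zero (s := Ω) fun x hx => by
      rw [image_eq_zero_of_notMem_tsupport fun h => hx (hs h), zero_smul]]
    refine ext_inner_left ℝ fun e => ?_
    have hsmul : Integrable (fun x => φ x • (G - G') x) (volume.restrict Ω) :=
      memLp_one_iff_integrable.1 (hG.smul hφ2)
    rw [← integral_inner hsmul]
    calc ∫ x in Ω, inner ℝ e (φ x • (G - G') x)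
        = ∫ x in Ω, (inner ℝ (G x) e * φ x - inner ℝ (G' x) e * φ x) := by
          congr 1 with x
          rw [Pi.sub_apply, real_inner_smul_right, real_inner_comm, inner_sub_left]
          ring
      _ = inner ℝ e 0 := by
          rw [integral_sub (hint h.memLp_grad e) (hint h'.memLp_grad e), inner_zero_right,
            sub_eq_zero, ← neg_inj, ← h.integral_eq φ hφ hc hs e, h'.integral_eq φ hφ hc hs e]
  have hloc : LocallyIntegrableOn (G - G') Ω :=
    locallyIntegrableOn_of_locallyIntegrable_restrict (hG.locallyIntegrable one_le_two)
  have h0 := ho.ae_eq_zero_of_integral_contDiff_smul_eq_zero hloc htest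
  filter_upwards [(ae_restrict_iff' ho.measurableSet).2 h0] with x hx using sub_eq_zero.1 hx

/-! ### Operators on `L²` and the Lax–Milgram theorem -/

section SquareIntegrable

variable {α E : Type*} [MeasurableSpace α] {μ : Measure α} [NormedAddCommGroup E]

theorem Lp_enorm_sq_eq_lintegral {f : Lp E 2 μ} {g : α → E} (h : f =ᵐ[μ] g) :
    ‖f‖ₑ ^ 2 = ∫⁻ x, ‖g x‖ₑ ^ 2 ∂μ := by
  have hpow := eLpNorm_nnreal_pow_eq_lintegral (μ := μ) (f := g) (p := 2) two_ne_zero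
  rw [Lp.enorm_def, eLpNorm_congr_ae h]
  simpa using hpow

theorem memLp_restrict_of_continuous [TopologicalSpace α] [OpensMeasurableSpace α]
    [SecondCountableTopology α] [TopologicalSpace.PseudoMetrizableSpace α] {S K : Set α}
    [IsFiniteMeasure (μ.restrict S)] (hK : IsCompact K) (hSK : S ⊆ K) (hS : MeasurableSet S)
    {f : α → E} (hf : Continuous f) (p : ℝ≥0∞) : MemLp f p (μ.restrict S) := by
  obtain ⟨C, hC⟩ := hK.exists_bound_of_continuousOn hf.continuousOn
  refine MemLp.of_bound hf.aestronglyMeasurable C ?_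
  filter_upwards [ae_restrict_mem hS] with x hx using hC x (hSK hx)

theorem tendsto_eLpNorm_sub_iff_tendsto {p : ℝ≥0∞} [Fact (1 ≤ p)] {ι : Type*} {l : Filter ι}
    {f : ι → α → E} {F : ι → Lp E p μ} (h : ∀ n, F n =ᵐ[μ] f n) (g : Lp E p μ) :
    Tendsto (fun n => eLpNorm (fun x => f n x - g x) p μ) l (𝓝 0) ↔ Tendsto F l (𝓝 g) := by
  rw [Lp.tendsto_Lp_iff_tendsto_eLpNorm']
  refine tendsto_congr fun n => eLpNorm_congr_ae ?_
  filter_upwards [h n] with x hx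
  rw [Pi.sub_apply, hx]

variable [InnerProductSpace ℝ E]

theorem inner_eq_integral_of_ae_eq {F : Lp E 2 μ} {f : α → E} (hF : F =ᵐ[μ] f) (v : Lp E 2 μ) :
    inner ℝ F v = ∫ x, inner ℝ (f x) (v x) ∂μ := by
  rw [L2.inner_def]
  refine integral_congr_ae ?_
  filter_upwards [hF] with x hx
  rw [hx]

variable {a : α → ℝ}

/-- Multiplication by a bounded function, as an operator on `L²`. -/
def mulL2 (ha : MemLp a ∞ μ) : Lp E 2 μ →L[ℝ] Lp E 2 μ :=
  (ContinuousLinearMap.lsmul ℝ ℝ).holderL μ ∞ 2 2 (ha.toLp a)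

theorem coeFn_mulL2 (ha : MemLp a ∞ μ) (f : Lp E 2 μ) : mulL2 ha f =ᵐ[μ] fun x => a x • f x := by
  filter_upwards [(ContinuousLinearMap.lsmul ℝ ℝ : ℝ →L[ℝ] E →L[ℝ] E).coeFn_holder
    (r := 2) (ha.toLp a) f, ha.coeFn_toLp] with x hx ha_x
  exact hx.trans (by rw [ha_x, ContinuousLinearMap.lsmul_apply])

theorem inner_mulL2 (ha : MemLp a ∞ μ) (f g : Lp E 2 μ) :
    inner ℝ (mulL2 ha f) g = ∫ x, a x * inner ℝ (f x) (g x) ∂μ := by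
  simp_rw [inner_eq_integral_of_ae_eq (coeFn_mulL2 ha f), real_inner_smul_left]

theorem inner_mulL2_comm (ha : MemLp a ∞ μ) (f g : Lp E 2 μ) :
    inner ℝ (mulL2 ha f) g = inner ℝ (mulL2 ha g) f := by
  simp_rw [inner_mulL2, real_inner_comm]

theorem mul_norm_sq_le_inner_mulL2 (ha : MemLp a ∞ μ) {m : ℝ} (hm : ∀ᵐ x ∂μ, m ≤ a x)
    (f : Lp E 2 μ) : m * ‖f‖ ^ 2 ≤ inner ℝ (mulL2 ha f) f := by
  have hint : Integrable (fun x => a x * inner ℝ (f x) (f x)) μ := by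
    refine (L2.integrable_inner (𝕜 := ℝ) (mulL2 ha f) f).congr ?_
    filter_upwards [coeFn_mulL2 ha f] with x hx
    rw [hx, real_inner_smul_left]
  rw [← real_inner_self_eq_norm_sq, inner_mulL2, L2.inner_def, ← integral_const_mul]
  refine integral_mono_ae ((L2.integrable_inner (𝕜 := ℝ) f f).const_mul m) hint ?_
  filter_upwards [hm] with x hx
  exact mul_le_mul_of_nonneg_right hx real_inner_self_nonneg

theorem inner_eq_integral_mul {F : Lp ℝ 2 μ} {f : α → ℝ} (hF : F =ᵐ[μ] f) (v : Lp ℝ 2 μ) :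
    inner ℝ F v = ∫ x, f x * v x ∂μ := by
  simp_rw [inner_eq_integral_of_ae_eq hF, Real.inner_apply]

end SquareIntegrable

section BilinearForms

variable {E : Type*} [NormedAddCommGroup E]

theorem exists_mem_forall_eq_of_coercive [InnerProductSpace ℝ E] [CompleteSpace E]
    {B : E →L[ℝ] E →L[ℝ] ℝ} {W : Submodule ℝ E} (hW : IsClosed (W : Set E)) {C : ℝ}
    (hC : 0 < C) (hB : ∀ x ∈ W, ‖x‖ ^ 2 ≤ C * B x x) (l : E →L[ℝ] ℝ) :
    ∃ x ∈ W, ∀ y ∈ W, B x y = l y := by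
  have : CompleteSpace W := hW.completeSpace_coe
  have hco : IsCoercive (B.bilinearComp W.subtypeL W.subtypeL) :=
    ⟨C⁻¹, inv_pos.2 hC, fun x => by
      simpa [sq, mul_assoc] using (inv_mul_le_iff₀ hC).2 (hB x x.2)⟩
  let r : W := (InnerProductSpace.toDual ℝ W).symm (l ∘L W.subtypeL)
  refine ⟨hco.continuousLinearEquivOfBilin.symm r, Subtype.coe_prop _, fun y hy => ?_⟩
  have hr := hco.continuousLinearEquivOfBilin_apply
    (hco.continuousLinearEquivOfBilin.symm r) ⟨y, hy⟩
  rw [ContinuousLinearEquiv.apply_symm_apply, InnerProductSpace.toDual_symm_apply] at hr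
  exact hr.symm

theorem norm_sq_le_mul_of_norm_sub_smul_sq_le [NormedSpace ℝ E] {B : E →L[ℝ] E →L[ℝ] ℝ}
    (hB : ∀ x, 0 ≤ B x x) {e x : E} (he : 0 < B e e) {C k : ℝ}
    (hx : ‖x - k • e‖ ^ 2 ≤ C * B x x) :
    ‖x‖ ^ 2 ≤ (2 * C + 2 * ‖e‖ ^ 2 * (2 + 2 * ‖B‖ * C) / B e e) * B x x := by
  set y := x - k • e with hy
  have hk : k ^ 2 * B e e ≤ (2 + 2 * ‖B‖ * C) * B x x := by
    have hpar : k ^ 2 * B e e + B (x + y) (x + y) = 2 * B x x + 2 * B y y := by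
      simp only [hy, map_add, map_sub, map_smul, add_apply, sub_apply, smul_apply, smul_eq_mul]
      ring
    have hyy : B y y ≤ ‖B‖ * (C * B x x) := calc
      B y y ≤ ‖B‖ * ‖y‖ * ‖y‖ := (Real.le_norm_self _).trans (B.le_opNorm₂ y y)
      _ = ‖B‖ * ‖y‖ ^ 2 := by ring
      _ ≤ ‖B‖ * (C * B x x) := by gcongr
    linarith [hB (x + y)]
  calc ‖x‖ ^ 2 = ‖y + k • e‖ ^ 2 := by rw [hy, sub_add_cancel]
    _ ≤ (‖y‖ + |k| * ‖e‖) ^ 2 := by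
        gcongr
        exact (norm_add_le _ _).trans_eq (by rw [norm_smul, Real.norm_eq_abs])
    _ ≤ 2 * (‖y‖ ^ 2 + (|k| * ‖e‖) ^ 2) := add_sq_le
    _ = 2 * ‖y‖ ^ 2 + 2 * ‖e‖ ^ 2 * k ^ 2 := by rw [mul_pow, sq_abs]; ring
    _ ≤ 2 * (C * B x x) + 2 * ‖e‖ ^ 2 * ((2 + 2 * ‖B‖ * C) * B x x / B e e) := by
        gcongr
        exact (le_div_iff₀ he).2 hk
    _ = _ := by ring

end BilinearForms

theorem existsUnique_integral_add_mul_eq_zero {X : Type*} [MeasurableSpace X] {μ : Measure X}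
    {f g : X → ℝ} (hf : Integrable f μ) (hg : Integrable g μ) (hne : ∫ x, g x ∂μ ≠ 0) :
    ∃! α : ℝ, ∫ x, (f x + α * g x) ∂μ = 0 := by
  have hint : ∀ α : ℝ, ∫ x, (f x + α * g x) ∂μ = 0 ↔ α * ∫ x, g x ∂μ = -∫ x, f x ∂μ := fun α => by
    rw [integral_add hf (hg.const_mul α), integral_const_mul, add_comm, eq_neg_iff_add_eq_zero]
  simp_rw [hint]
  exact (mulRight_bijective₀ _ hne).existsUnique _

/-! ### The space `H¹(Ω)` of functions with their gradients and traces -/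

namespace Setting

section SobolevSpace

variable (D : Setting)

theorem isCompact_frontier : IsCompact (frontier D.Ω) :=
  D.isBounded.isCompact_closure.of_isClosed_subset isClosed_frontier frontier_subset_closure

instance : IsFiniteMeasure (bdryMeasure D.Ω) := by
  obtain ⟨C, hC, htrace⟩ := D.lipschitz.trace ℝ D.isOpen D.isBounded
  have hone := htrace (fun _ => 1) contDiff_const
  simp_rw [← enorm_gradient] at hone
  refine ⟨lt_of_le_of_lt ?_ (ENNReal.mul_lt_top hC.lt_top (measure_lt_top (volume.restrict D.Ω)
    Set.univ))⟩
  simpa using hone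

theorem memLp_of_continuous {E : Type*} [NormedAddCommGroup E] {f : Plane → E} (hf : Continuous f)
    (p : ℝ≥0∞) : MemLp f p (volume.restrict D.Ω) :=
  memLp_restrict_of_continuous D.isBounded.isCompact_closure subset_closure
    D.isOpen.measurableSet hf p

theorem memLp_bdry_of_continuous {E : Type*} [NormedAddCommGroup E] {f : Plane → E}
    (hf : Continuous f) (p : ℝ≥0∞) : MemLp f p (bdryMeasure D.Ω) :=
  memLp_restrict_of_continuous D.isCompact_frontier le_rfl isClosed_frontier.measurableSet hf p

/-- The Hilbert space `L²(Ω) × L²(Ω; ℝ²) × L²(∂Ω)`, in which an `H¹` function is represented by the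
triple of the function, its gradient and its trace. -/
abbrev GraphSpace : Type := WithLp 2 (D.L2 × WithLp 2 (D.L2vec × D.L2bdry))

variable {D}

/-- The function of a triple. -/
def val : D.GraphSpace →L[ℝ] D.L2 := WithLp.fstL 2 ℝ _ _

/-- The gradient of a triple. -/
def grad : D.GraphSpace →L[ℝ] D.L2vec := WithLp.fstL 2 ℝ _ _ ∘L WithLp.sndL 2 ℝ _ _

/-- The boundary values of a triple. -/
def trace : D.GraphSpace →L[ℝ] D.L2bdry := WithLp.sndL 2 ℝ _ _ ∘L WithLp.sndL 2 ℝ _ _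

/-- The triple with given components. -/
def triple (s : D.L2) (G : D.L2vec) (g : D.L2bdry) : D.GraphSpace :=
  WithLp.toLp 2 (s, WithLp.toLp 2 (G, g))

variable {s : D.L2} {G : D.L2vec} {g : D.L2bdry} {x : D.GraphSpace}

theorem norm_sq_eq (x : D.GraphSpace) : ‖x‖ ^ 2 = ‖val x‖ ^ 2 + ‖grad x‖ ^ 2 + ‖trace x‖ ^ 2 := by
  rw [WithLp.prod_norm_sq_eq_of_L2, WithLp.prod_norm_sq_eq_of_L2, add_assoc]
  rfl

theorem tendsto_graphSpace {ι : Type*} {l : Filter ι} {y : ι → D.GraphSpace} :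
    Tendsto y l (𝓝 x) ↔ Tendsto (fun n => val (y n)) l (𝓝 (val x)) ∧
      Tendsto (fun n => grad (y n)) l (𝓝 (grad x)) ∧
      Tendsto (fun n => trace (y n)) l (𝓝 (trace x)) := by
  refine ⟨fun h => ⟨(val.continuous.tendsto x).comp h, (grad.continuous.tendsto x).comp h,
    (trace.continuous.tendsto x).comp h⟩, fun ⟨hval, hgrad, htrace⟩ => ?_⟩
  exact ((WithLp.prod_continuous_toLp 2 _ _).tendsto _).comp (hval.prodMk_nhds
    (((WithLp.prod_continuous_toLp 2 _ _).tendsto _).comp (hgrad.prodMk_nhds htrace)))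

variable (D) in
/-- The triples that come from functions smooth on the whole plane. -/
def smooth : Submodule ℝ D.GraphSpace where
  carrier := {x | ∃ u : Plane → ℝ, ContDiff ℝ ∞ u ∧ val x =ᵐ[volume.restrict D.Ω] u ∧
    grad x =ᵐ[volume.restrict D.Ω] gradient u ∧ trace x =ᵐ[bdryMeasure D.Ω] u}
  add_mem' := by
    rintro x y ⟨u, hu, hxu, hxG, hxt⟩ ⟨v, hv, hyv, hyG, hyt⟩
    refine ⟨u + v, hu.add hv, (Lp.coeFn_add _ _).trans (hxu.add hyv),
      (Lp.coeFn_add _ _).trans ((hxG.add hyG).trans (Eventually.of_forall fun z => ?_)),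
      (Lp.coeFn_add _ _).trans (hxt.add hyt)⟩
    exact (gradient_add (hu.differentiable (by simp) z) (hv.differentiable (by simp) z)).symm
  zero_mem' := ⟨0, contDiff_const, Lp.coeFn_zero _ _ _,
    (Lp.coeFn_zero _ _ _).trans (Eventually.of_forall fun z => (gradient_const z 0).symm),
    Lp.coeFn_zero _ _ _⟩
  smul_mem' := by
    rintro k x ⟨u, hu, hxu, hxG, hxt⟩
    refine ⟨k • u, hu.const_smul k, (Lp.coeFn_smul _ _).trans (hxu.const_smul k),
      (Lp.coeFn_smul _ _).trans ((hxG.const_smul k).trans (Eventually.of_forall fun z => ?_)),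
      (Lp.coeFn_smul _ _).trans (hxt.const_smul k)⟩
    exact (gradient_const_smul (hu.differentiable (by simp) z) k).symm

variable (D) in
/-- The space `H¹(Ω)`, as the closure of the smooth triples. -/
def H1 : Submodule ℝ D.GraphSpace := D.smooth.topologicalClosure

theorem H1_subset_of_isClosed {S : Set D.GraphSpace} (hS : IsClosed S)
    (h : (D.smooth : Set D.GraphSpace) ⊆ S) : (D.H1 : Set D.GraphSpace) ⊆ S :=
  closure_minimal h hS

theorem hasTrace_iff_mem_H1 : HasTrace D.Ω (val x) (grad x) (trace x) ↔ x ∈ D.H1 := by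
  rw [H1, ← SetLike.mem_coe, Submodule.topologicalClosure_coe, mem_closure_iff_seq_limit]
  constructor
  · rintro ⟨φ, hφ, hval, hgrad, htrace⟩
    have hφ_mem := fun n => D.memLp_of_continuous (hφ n).continuous 2
    have hG_mem := fun n => D.memLp_of_continuous (continuous_gradient ((hφ n).of_le (by simp))) 2
    have ht_mem := fun n => D.memLp_bdry_of_continuous (hφ n).continuous 2
    refine ⟨fun n => triple ((hφ_mem n).toLp _) ((hG_mem n).toLp _) ((ht_mem n).toLp _), fun n =>
      ⟨φ n, hφ n, (hφ_mem n).coeFn_toLp, (hG_mem n).coeFn_toLp, (ht_mem n).coeFn_toLp⟩,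
      tendsto_graphSpace.2 ⟨?_, ?_, ?_⟩⟩
    · exact (tendsto_eLpNorm_sub_iff_tendsto (fun n => (hφ_mem n).coeFn_toLp) _).1 hval
    · exact (tendsto_eLpNorm_sub_iff_tendsto (fun n => (hG_mem n).coeFn_toLp) _).1 hgrad
    · exact (tendsto_eLpNorm_sub_iff_tendsto (fun n => (ht_mem n).coeFn_toLp) _).1 htrace
  · rintro ⟨y, hy, hlim⟩
    choose φ hφ hval hgrad htrace using hy
    obtain ⟨hval', hgrad', htrace'⟩ := tendsto_graphSpace.1 hlim
    exact ⟨φ, hφ, (tendsto_eLpNorm_sub_iff_tendsto hval _).2 hval',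
      (tendsto_eLpNorm_sub_iff_tendsto hgrad _).2 hgrad',
      (tendsto_eLpNorm_sub_iff_tendsto htrace _).2 htrace'⟩

theorem isWeakGradient_of_mem_H1 (hx : x ∈ D.H1) : IsWeakGradient D.Ω (val x) (grad x) := by
  refine ⟨Lp.memLp _, Lp.memLp _, fun φ hφ hc hs e => ?_⟩
  have hφ1 : ContDiff ℝ 1 φ := hφ.of_le (by simp)
  have hdφ := D.memLp_of_continuous
    ((hφ1.continuous_fderiv one_ne_zero).clm_apply (continuous_const (y := e))) 2
  have hφe : MemLp (fun z => φ z • e) 2 (volume.restrict D.Ω) :=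
    D.memLp_of_continuous (hφ.continuous.smul continuous_const) 2
  have hval : ∀ s : D.L2, inner ℝ (hdφ.toLp _) s = ∫ z in D.Ω, s z * fderiv ℝ φ z e :=
    fun s => inner_eq_integral_of_ae_eq hdφ.coeFn_toLp s
  have hgrad : ∀ G : D.L2vec, inner ℝ (hφe.toLp _) G = ∫ z in D.Ω, inner ℝ (G z) e * φ z :=
    fun G => (inner_eq_integral_of_ae_eq hφe.coeFn_toLp G).trans <| by
      simp_rw [real_inner_smul_left, mul_comm (φ _), real_inner_comm e]
  have hclosed : IsClosed {y : D.GraphSpace |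
      inner ℝ (hdφ.toLp _) (val y) = -inner ℝ (hφe.toLp _) (grad y)} :=
    isClosed_eq (by fun_prop) (by fun_prop)
  rw [← hval, ← hgrad]
  refine H1_subset_of_isClosed hclosed ?_ hx
  rintro y ⟨u, hu, hyu, hyG, -⟩
  rw [Set.mem_ofPred_eq, hval, hgrad]
  calc ∫ z in D.Ω, val y z * fderiv ℝ φ z e = ∫ z in D.Ω, u z * fderiv ℝ φ z e :=
        integral_congr_ae (by filter_upwards [hyu] with z hz; rw [hz])
    _ = -∫ z in D.Ω, inner ℝ (gradient u z) e * φ z :=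
        setIntegral_mul_fderiv_eq_neg_inner_gradient (hu.of_le (by simp)) hφ1 hc hs e
    _ = -∫ z in D.Ω, inner ℝ (grad y z) e * φ z :=
        congrArg _ (integral_congr_ae (by filter_upwards [hyG] with z hz; rw [hz]))

end SobolevSpace

/-! ### Boundary conditions -/

section AdmissibleSpace

variable {D : Setting} {x : D.GraphSpace}

theorem ΓD_subset_frontier : D.ΓD ⊆ frontier D.Ω := by
  rw [← D.cover]
  exact fun x hx => Or.inl (Or.inl (Or.inr hx))

theorem ΓR_subset_frontier : D.ΓR ⊆ frontier D.Ω := by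
  rw [← D.cover]
  exact fun x hx => Or.inl (Or.inr hx)

theorem perPart_subset_frontier (k : Fin D.numPer) : D.perPart k ⊆ frontier D.Ω := by
  rw [← D.cover, D.Γper_eq]
  exact fun x hx => Or.inr (Set.mem_iUnion.2 ⟨k, Or.inl hx⟩)

theorem perShift_add_mem_frontier {k : Fin D.numPer} {x : Plane} (hx : x ∈ D.perPart k) :
    D.perShift k + x ∈ frontier D.Ω := by
  rw [← D.cover, D.Γper_eq]
  exact Or.inr (Set.mem_iUnion.2 ⟨k, Or.inr ⟨x, hx, rfl⟩⟩)

theorem ae_perPart_perShift_add (k : Fin D.numPer) {p : Plane → Prop}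
    (h : ∀ᵐ x ∂(bdryMeasure D.Ω), p x) :
    ∀ᵐ x ∂((μH[1]).restrict (D.perPart k)), p (D.perShift k + x) := by
  rw [ae_iff, Measure.restrict_apply' isClosed_frontier.measurableSet] at h
  rw [ae_iff, Measure.restrict_apply' (D.measurable_perPart k)]
  refine measure_mono_null (fun x hx => ?_)
    (((IsometryEquiv.addLeft (D.perShift k)).hausdorffMeasure_preimage 1 _).trans h)
  exact ⟨hx.1, perShift_add_mem_frontier hx.2⟩

variable (D) in
/-- The boundary values that vanish on `ΓD` and are periodic on `Γper`. -/
def bdryValues : Submodule ℝ D.L2bdry where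
  carrier := {g | (∀ᵐ x ∂((μH[1]).restrict D.ΓD), g x = 0) ∧
    ∀ k, ∀ᵐ x ∂((μH[1]).restrict (D.perPart k)), g (D.perShift k + x) = g x}
  add_mem' := by
    rintro g g' ⟨hg, hgper⟩ ⟨hg', hgper'⟩
    have hadd := Lp.coeFn_add g g'
    refine ⟨?_, fun k => ?_⟩
    · filter_upwards [hg, hg',
        ae_restrict_of_ae_restrict_of_subset ΓD_subset_frontier hadd] with x hx hx' hsum
      rw [hsum, Pi.add_apply, hx, hx', add_zero]
    · filter_upwards [hgper k, hgper' k,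
        ae_restrict_of_ae_restrict_of_subset (perPart_subset_frontier k) hadd,
        ae_perPart_perShift_add k hadd] with x hx hx' hsum hsum'
      rw [hsum, hsum', Pi.add_apply, Pi.add_apply, hx, hx']
  zero_mem' := by
    have hzero := Lp.coeFn_zero ℝ 2 (bdryMeasure D.Ω)
    refine ⟨ae_restrict_of_ae_restrict_of_subset ΓD_subset_frontier hzero, fun k => ?_⟩
    filter_upwards [ae_restrict_of_ae_restrict_of_subset (perPart_subset_frontier k) hzero,
      ae_perPart_perShift_add k hzero] with x hx hx'
    rw [hx, hx', Pi.zero_apply, Pi.zero_apply]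
  smul_mem' := by
    rintro r g ⟨hg, hgper⟩
    have hsmul := Lp.coeFn_smul r g
    refine ⟨?_, fun k => ?_⟩
    · filter_upwards [hg,
        ae_restrict_of_ae_restrict_of_subset ΓD_subset_frontier hsmul] with x hx hr
      rw [hr, Pi.smul_apply, hx, smul_zero]
    · filter_upwards [hgper k,
        ae_restrict_of_ae_restrict_of_subset (perPart_subset_frontier k) hsmul,
        ae_perPart_perShift_add k hsmul] with x hx hr hr'
      rw [hr, hr', Pi.smul_apply, Pi.smul_apply, hx]

theorem isClosed_bdryValues : IsClosed (D.bdryValues : Set D.L2bdry) := by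
  refine IsSeqClosed.isClosed fun g g' hg hlim => ?_
  obtain ⟨ns, -, hns⟩ := (tendstoInMeasure_of_tendsto_Lp hlim).exists_seq_tendsto_ae
  refine ⟨?_, fun k => ?_⟩
  · filter_upwards [ae_all_iff.2 fun n => (hg n).1,
      ae_restrict_of_ae_restrict_of_subset ΓD_subset_frontier hns] with x hx hlim_x
    simp only [hx] at hlim_x
    exact tendsto_nhds_unique hlim_x tendsto_const_nhds
  · filter_upwards [ae_all_iff.2 fun n => (hg n).2 k,
      ae_restrict_of_ae_restrict_of_subset (perPart_subset_frontier k) hns,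
      ae_perPart_perShift_add k hns] with x hx hlim_x hlim_shift
    simp only [hx] at hlim_shift
    exact tendsto_nhds_unique hlim_shift hlim_x

variable (D) in
/-- The space `V` of the admissible functions, represented by triples. -/
def V : Submodule ℝ D.GraphSpace :=
  D.H1 ⊓ D.bdryValues.comap (trace : D.GraphSpace →L[ℝ] D.L2bdry).toLinearMap

theorem mem_V_iff : x ∈ D.V ↔ D.Admissible (val x) (grad x) (trace x) :=
  ⟨fun h => ⟨isWeakGradient_of_mem_H1 h.1, hasTrace_iff_mem_H1.2 h.1, h.2.1, h.2.2⟩,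
    fun h => ⟨hasTrace_iff_mem_H1.1 h.trace, h.dirichlet, h.periodic⟩⟩

theorem triple_mem_V {s : D.L2} {G : D.L2vec} {g : D.L2bdry} (h : D.Admissible s G g) :
    triple s G g ∈ D.V :=
  mem_V_iff.2 h

theorem isClosed_V : IsClosed (D.V : Set D.GraphSpace) :=
  D.smooth.isClosed_topologicalClosure.inter (isClosed_bdryValues.preimage trace.continuous)

/-! ### Constants and averages -/

variable (D) in
/-- The constant function `1`, with its gradient and its boundary values. -/
def one : D.GraphSpace := triple (D.const 1) 0 (Lp.const 2 (bdryMeasure D.Ω) 1)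

theorem const_eq_smul_val_one (r : ℝ) : D.const r = r • val D.one := by
  have hsmul := (Lp.constₗ 2 (volume.restrict D.Ω) ℝ : ℝ →ₗ[ℝ] D.L2).map_smul r 1
  rwa [smul_eq_mul, mul_one] at hsmul

theorem coeFn_val_one : val D.one =ᵐ[volume.restrict D.Ω] fun _ => 1 := Lp.coeFn_const _ _ _

theorem coeFn_trace_one : trace D.one =ᵐ[bdryMeasure D.Ω] fun _ => 1 := Lp.coeFn_const _ _ _

theorem grad_one : grad D.one = 0 := rfl

theorem one_mem_smooth : D.one ∈ D.smooth :=
  ⟨fun _ => 1, contDiff_const, coeFn_val_one, (Lp.coeFn_zero _ _ _).trans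
    (Eventually.of_forall fun z => (gradient_fun_const z 1).symm), coeFn_trace_one⟩

theorem one_mem_H1 : D.one ∈ D.H1 := D.smooth.le_topologicalClosure one_mem_smooth

theorem one_mem_V (h : ¬ D.ConstantsControlled) : D.one ∈ D.V := by
  have hΓD : (μH[1] : Measure Plane).restrict D.ΓD = 0 :=
    Measure.restrict_eq_zero.2 (measure_mono_null Set.subset_union_left (not_not.1 h))
  refine ⟨one_mem_H1, by simp [hΓD], fun k => ?_⟩
  filter_upwards [ae_perPart_perShift_add k coeFn_trace_one,
    ae_restrict_of_ae_restrict_of_subset (perPart_subset_frontier k) coeFn_trace_one] with x hx hx'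
  exact hx.trans hx'.symm

theorem inner_val_one (s : D.L2) : inner ℝ (val D.one) s = ∫ x in D.Ω, s x := by
  simp_rw [inner_eq_integral_mul coeFn_val_one, one_mul]

theorem val_one_ne_zero : val D.one ≠ 0 := fun h => by
  have hfalse : ∀ᵐ _ ∂(volume.restrict D.Ω), False := by
    filter_upwards [coeFn_val_one (D := D), Lp.coeFn_zero ℝ 2 (volume.restrict D.Ω)] with x hx hx'
    rw [h, hx'] at hx
    exact zero_ne_one hx
  exact (D.isOpen.measure_pos volume D.isConnected.nonempty).ne'
    (Measure.restrict_eq_zero.1 (ae_eq_bot.1 (eventually_false_iff_eq_bot.1 hfalse)))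

variable (D) in
/-- The average over `Ω`. -/
def mean : D.L2 →L[ℝ] ℝ := (‖val D.one‖ ^ 2)⁻¹ • innerSL ℝ (val D.one)

theorem mean_val_one : D.mean (val D.one) = 1 := by
  simp [mean, val_one_ne_zero]

theorem norm_sub_mean_smul_le (s : D.L2) (k : ℝ) :
    ‖s - D.mean s • val D.one‖ ≤ ‖s - k • val D.one‖ := by
  have hproj : D.mean s • val D.one = (ℝ ∙ val D.one).starProjection s := by
    rw [Submodule.starProjection_singleton, mean]
    simp [div_eq_inv_mul]
  rw [hproj, Submodule.starProjection_minimal]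
  exact ciInf_le ⟨0, Set.forall_mem_range.2 fun _ => norm_nonneg _⟩
    (⟨k • val D.one, Submodule.smul_mem _ _ (Submodule.mem_span_singleton_self _)⟩ :
      ℝ ∙ val D.one)

/-! ### Poincaré and trace inequalities on `H¹(Ω)` -/

variable (D) in
theorem exists_norm_trace_sq_le :
    ∃ C : ℝ, 0 ≤ C ∧ ∀ x ∈ D.H1, ‖trace x‖ ^ 2 ≤ C * (‖val x‖ ^ 2 + ‖grad x‖ ^ 2) := by
  obtain ⟨C, hC, htrace⟩ := D.lipschitz.trace ℝ D.isOpen D.isBounded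
  have hclosed : IsClosed {x : D.GraphSpace |
      ‖trace x‖ ^ 2 ≤ C.toReal * (‖val x‖ ^ 2 + ‖grad x‖ ^ 2)} :=
    isClosed_le (by fun_prop) (by fun_prop)
  refine ⟨C.toReal, ENNReal.toReal_nonneg, H1_subset_of_isClosed hclosed ?_⟩
  rintro x ⟨u, hu, hval, hgrad, htr⟩
  have hle := htrace u (hu.of_le (by simp))
  simp_rw [← enorm_gradient] at hle
  rw [← Lp_enorm_sq_eq_lintegral hval, ← Lp_enorm_sq_eq_lintegral hgrad,
    ← Lp_enorm_sq_eq_lintegral htr] at hle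
  have hreal := ENNReal.toReal_mono (by finiteness) hle
  rwa [ENNReal.toReal_mul, ENNReal.toReal_add (by finiteness) (by finiteness), ENNReal.toReal_pow,
    ENNReal.toReal_pow, ENNReal.toReal_pow, toReal_enorm, toReal_enorm, toReal_enorm] at hreal

variable (D) in
theorem exists_norm_val_sub_mean_sq_le :
    ∃ C : ℝ, 0 ≤ C ∧ ∀ x ∈ D.H1,
      ‖val x - D.mean (val x) • val D.one‖ ^ 2 ≤ C * ‖grad x‖ ^ 2 := by
  obtain ⟨C, hC, hpoincare⟩ := D.lipschitz.poincareOn ℝ D.isOpen D.isConnected D.isBounded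
  have hclosed : IsClosed {x : D.GraphSpace |
      ‖val x - D.mean (val x) • val D.one‖ ^ 2 ≤ C.toReal * ‖grad x‖ ^ 2} :=
    isClosed_le (by fun_prop) (by fun_prop)
  refine ⟨C.toReal, ENNReal.toReal_nonneg, H1_subset_of_isClosed hclosed ?_⟩
  rintro x ⟨u, hu, hval, hgrad, -⟩
  obtain ⟨k, hk⟩ := hpoincare u (hu.of_le (by simp))
  have hsub : val x - k • val D.one =ᵐ[volume.restrict D.Ω] fun z => u z - k := by
    filter_upwards [Lp.coeFn_sub (val x) (k • val D.one), Lp.coeFn_smul k (val D.one), hval,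
      coeFn_val_one (D := D)] with z hz hz' hu hone
    rw [hz, Pi.sub_apply, hz', Pi.smul_apply, hu, hone, smul_eq_mul, mul_one]
  simp_rw [← enorm_gradient] at hk
  rw [← Lp_enorm_sq_eq_lintegral hsub, ← Lp_enorm_sq_eq_lintegral hgrad] at hk
  have hreal := ENNReal.toReal_mono (by finiteness) hk
  rw [ENNReal.toReal_mul, ENNReal.toReal_pow, ENNReal.toReal_pow, toReal_enorm, toReal_enorm]
    at hreal
  exact (pow_le_pow_left₀ (norm_nonneg _) (norm_sub_mean_smul_le _ k) 2).trans hreal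

variable (D) in
theorem exists_norm_sub_mean_smul_one_sq_le :
    ∃ C : ℝ, 0 ≤ C ∧ ∀ x ∈ D.H1, ‖x - D.mean (val x) • D.one‖ ^ 2 ≤ C * ‖grad x‖ ^ 2 := by
  obtain ⟨P, hP, hpoincare⟩ := D.exists_norm_val_sub_mean_sq_le
  obtain ⟨C, hC, htrace⟩ := D.exists_norm_trace_sq_le
  refine ⟨P + 1 + C * (P + 1), by positivity, fun x hx => ?_⟩
  have hval := hpoincare x hx
  have htr := htrace _ (sub_mem hx (Submodule.smul_mem _ (D.mean (val x)) one_mem_H1))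
  have hgrad : grad (x - D.mean (val x) • D.one) = grad x := by
    rw [map_sub, map_smul, grad_one, smul_zero, sub_zero]
  rw [← map_smul, ← map_sub] at hval
  rw [hgrad] at htr
  rw [norm_sq_eq, hgrad]
  calc _ ≤ P * ‖grad x‖ ^ 2 + ‖grad x‖ ^ 2 + C * (P * ‖grad x‖ ^ 2 + ‖grad x‖ ^ 2) := by
        gcongr
        exact htr.trans (by gcongr)
    _ = _ := by ring

end AdmissibleSpace

/-! ### The energy form -/

section PoissonProblem

variable {D : Setting} {x y : D.GraphSpace}

variable (D) in
/-- The boundary weight of the energy form: `a` on `ΓR`, and `1` on `ΓD`, which does not affect the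
form on the functions that vanish there but makes it positive on the constants as soon as they are
controlled. -/
def weight : Plane → ℝ := D.ΓR.indicator D.a + D.ΓD.indicator fun _ => 1

theorem memLp_weight : MemLp D.weight ∞ (bdryMeasure D.Ω) := by
  refine MemLp.add ?_ ((memLp_const 1).indicator D.measurable_ΓD)
  rw [memLp_indicator_iff_restrict D.measurable_ΓR,
    Measure.restrict_restrict D.measurable_ΓR, Set.inter_eq_left.2 ΓR_subset_frontier]
  exact D.a_bdd

theorem weight_of_mem_ΓR {z : Plane} (hz : z ∈ D.ΓR) : D.weight z = D.a z := by
  simp [weight, hz, Set.disjoint_right.1 D.disjoint_DR hz]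

theorem weight_of_mem_ΓD {z : Plane} (hz : z ∈ D.ΓD) : D.weight z = 1 := by
  simp [weight, hz, Set.disjoint_left.1 D.disjoint_DR hz]

theorem weight_of_notMem {z : Plane} (hz : z ∉ D.ΓD ∪ D.ΓR) : D.weight z = 0 := by
  rw [weight, Pi.add_apply, Set.indicator_of_notMem fun h => hz (Or.inr h),
    Set.indicator_of_notMem fun h => hz (Or.inl h), add_zero]

theorem ae_weight_pos : ∀ᵐ z ∂(bdryMeasure D.Ω), z ∈ D.ΓD ∪ D.ΓR → 0 < D.weight z := by
  filter_upwards [ae_restrict_of_ae ((ae_restrict_iff' D.measurable_ΓR).1 D.a_pos)] with z ha hz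
  rcases hz with hD | hR
  · exact (weight_of_mem_ΓD hD).symm ▸ one_pos
  · exact (weight_of_mem_ΓR hR).symm ▸ ha hR

theorem ae_weight_nonneg : ∀ᵐ z ∂(bdryMeasure D.Ω), 0 ≤ D.weight z := by
  filter_upwards [ae_weight_pos (D := D)] with z hpos
  by_cases hz : z ∈ D.ΓD ∪ D.ΓR
  · exact (hpos hz).le
  · exact (weight_of_notMem hz).ge

theorem weight_ae_eq_zero_iff : D.weight =ᵐ[bdryMeasure D.Ω] 0 ↔ ¬ D.ConstantsControlled := by
  have hzero : ∀ᵐ z ∂(bdryMeasure D.Ω), D.weight z = 0 ↔ z ∉ D.ΓD ∪ D.ΓR := by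
    filter_upwards [ae_weight_pos (D := D)] with z hpos
    exact ⟨fun h hz => (hpos hz).ne' h, weight_of_notMem⟩
  rw [ConstantsControlled, not_not, EventuallyEq]
  simp only [Pi.zero_apply]
  rw [eventually_congr hzero, ← measure_eq_zero_iff_ae_notMem,
    Measure.restrict_apply (D.measurable_ΓD.union D.measurable_ΓR),
    Set.inter_eq_left.2 (Set.union_subset ΓD_subset_frontier ΓR_subset_frontier)]

variable (D) in
/-- The form `∫_Ω σ ∇x·∇y + ∫_∂Ω weight x y`, which agrees with `Setting.form` on `V`. -/
def energy : D.GraphSpace →L[ℝ] D.GraphSpace →L[ℝ] ℝ :=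
  (innerSL ℝ : D.L2vec →L[ℝ] D.L2vec →L[ℝ] ℝ).bilinearComp (mulL2 D.σ_bdd ∘L grad) grad +
    (innerSL ℝ : D.L2bdry →L[ℝ] D.L2bdry →L[ℝ] ℝ).bilinearComp (mulL2 memLp_weight ∘L trace) trace

theorem energy_apply (x y : D.GraphSpace) : D.energy x y =
    inner ℝ (mulL2 D.σ_bdd (grad x)) (grad y) + inner ℝ (mulL2 memLp_weight (trace x)) (trace y) :=
  rfl

theorem energy_comm (x y : D.GraphSpace) : D.energy x y = D.energy y x := by
  rw [energy_apply, energy_apply, inner_mulL2_comm, inner_mulL2_comm memLp_weight]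

theorem form_eq_energy (hx : x ∈ D.V) (y : D.GraphSpace) :
    D.form (grad x) (trace x) (grad y) (trace y) = D.energy x y := by
  have hΓD : ∀ᵐ z ∂(bdryMeasure D.Ω), z ∈ D.ΓD → trace x z = 0 :=
    ae_restrict_of_ae ((ae_restrict_iff' D.measurable_ΓD).1 hx.2.1)
  rw [energy_apply, inner_mulL2, inner_mulL2, form, ← Set.inter_eq_left.2 ΓR_subset_frontier,
    ← Measure.restrict_restrict D.measurable_ΓR, ← integral_indicator D.measurable_ΓR]
  congr 1
  refine integral_congr_ae ?_
  filter_upwards [hΓD] with z hz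
  rw [Real.inner_apply]
  by_cases hR : z ∈ D.ΓR
  · rw [Set.indicator_of_mem hR, weight_of_mem_ΓR hR]
    ring
  rw [Set.indicator_of_notMem hR]
  by_cases hD : z ∈ D.ΓD
  · rw [hz hD, zero_mul, mul_zero]
  · rw [weight_of_notMem (not_or.2 ⟨hD, hR⟩), zero_mul]

variable (D) in
theorem exists_mul_norm_grad_sq_le_energy :
    ∃ m : ℝ, 0 < m ∧ ∀ x : D.GraphSpace, m * ‖grad x‖ ^ 2 ≤ D.energy x x := by
  obtain ⟨m, hm, hσ⟩ := D.σ_pos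
  refine ⟨m, hm, fun x => ?_⟩
  have hgrad := mul_norm_sq_le_inner_mulL2 D.σ_bdd hσ (grad x)
  have htrace := mul_norm_sq_le_inner_mulL2 memLp_weight ae_weight_nonneg (trace x)
  rw [energy_apply]
  linarith

theorem energy_self_nonneg (x : D.GraphSpace) : 0 ≤ D.energy x x := by
  obtain ⟨m, hm, hgrad⟩ := D.exists_mul_norm_grad_sq_le_energy
  exact le_trans (by positivity) (hgrad x)

theorem energy_of_not_controlled (h : ¬ D.ConstantsControlled) (x y : D.GraphSpace) :
    D.energy x y = ∫ z in D.Ω, D.σ z * inner ℝ (grad x z) (grad y z) := by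
  rw [energy_apply, inner_mulL2, inner_mulL2 memLp_weight, add_eq_left]
  refine integral_eq_zero_of_ae ?_
  filter_upwards [weight_ae_eq_zero_iff.2 h] with z hz
  rw [hz, Pi.zero_apply, zero_mul]

theorem energy_one_of_not_controlled (h : ¬ D.ConstantsControlled) (x : D.GraphSpace) :
    D.energy D.one x = 0 := by
  rw [energy_of_not_controlled h, ← inner_mulL2 D.σ_bdd, grad_one, map_zero, inner_zero_left]

theorem energy_one_one_pos (h : D.ConstantsControlled) : 0 < D.energy D.one D.one := by
  have hone : D.energy D.one D.one = ∫ z, D.weight z ∂(bdryMeasure D.Ω) := by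
    rw [energy_apply, grad_one, inner_zero_right, zero_add, inner_mulL2]
    refine integral_congr_ae ?_
    filter_upwards [coeFn_trace_one (D := D)] with z hz
    rw [hz, Real.inner_apply, mul_one, mul_one]
  refine (energy_self_nonneg _).lt_of_ne' fun hzero => ?_
  rw [hone, integral_eq_zero_iff_of_nonneg_ae ae_weight_nonneg
    (memLp_weight.integrable le_top)] at hzero
  exact weight_ae_eq_zero_iff.1 hzero h

variable (D) in
theorem exists_norm_sub_mean_smul_one_sq_le_energy : ∃ C : ℝ, 0 < C ∧ ∀ x ∈ D.H1,
    ‖x - D.mean (val x) • D.one‖ ^ 2 ≤ C * D.energy x x := by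
  obtain ⟨m, hm, hgrad⟩ := D.exists_mul_norm_grad_sq_le_energy
  obtain ⟨P, hP, hpoincare⟩ := D.exists_norm_sub_mean_smul_one_sq_le
  refine ⟨(P + 1) / m, by positivity, fun x hx => ?_⟩
  calc ‖x - D.mean (val x) • D.one‖ ^ 2 ≤ P * ‖grad x‖ ^ 2 := hpoincare x hx
    _ ≤ (P + 1) / m * (m * ‖grad x‖ ^ 2) := by
        rw [← mul_assoc, div_mul_cancel₀ _ hm.ne']
        gcongr
        linarith
    _ ≤ (P + 1) / m * D.energy x x := by gcongr; exact hgrad x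

theorem exists_norm_sq_le_energy (h : D.ConstantsControlled) :
    ∃ C : ℝ, 0 < C ∧ ∀ x ∈ D.H1, ‖x‖ ^ 2 ≤ C * D.energy x x := by
  obtain ⟨C, hC, hmean⟩ := D.exists_norm_sub_mean_smul_one_sq_le_energy
  have hone := energy_one_one_pos h
  exact ⟨_, by positivity, fun x hx =>
    norm_sq_le_mul_of_norm_sub_smul_sq_le energy_self_nonneg hone (hmean x hx)⟩

theorem eq_mean_smul_one_of_energy_self_eq_zero (hx : x ∈ D.H1) (h : D.energy x x = 0) :
    x = D.mean (val x) • D.one := by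
  obtain ⟨C, -, hmean⟩ := D.exists_norm_sub_mean_smul_one_sq_le_energy
  have hle := hmean x hx
  rw [h, mul_zero] at hle
  exact sub_eq_zero.1 (norm_eq_zero.1 (pow_eq_zero_iff two_ne_zero |>.1 (hle.antisymm (by simp))))

/-! ### The Poisson problem in the cross section -/

/-- `x` solves `div (σ ∇x) = F` with the lateral boundary conditions, in the weak sense. -/
def IsPoissonSolution (F : D.L2) (x : D.GraphSpace) : Prop :=
  x ∈ D.V ∧ ∀ v ∈ D.V, D.energy x v = -inner ℝ F (val v)

namespace IsPoissonSolution

variable {F F' : D.L2}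

theorem zero : IsPoissonSolution 0 (0 : D.GraphSpace) :=
  ⟨zero_mem _, fun v _ => by rw [map_zero, zero_apply, inner_zero_left, neg_zero]⟩

theorem add (hx : IsPoissonSolution F x) (hy : IsPoissonSolution F' y) :
    IsPoissonSolution (F + F') (x + y) :=
  ⟨add_mem hx.1 hy.1, fun v hv => by
    rw [map_add, add_apply, hx.2 v hv, hy.2 v hv, inner_add_left, neg_add]⟩

theorem const_smul (hx : IsPoissonSolution F x) (k : ℝ) : IsPoissonSolution (k • F) (k • x) :=
  ⟨Submodule.smul_mem _ k hx.1, fun v hv => by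
    rw [map_smul, smul_apply, hx.2 v hv, real_inner_smul_left, smul_eq_mul, mul_neg]⟩

theorem energy_sub_self (hx : IsPoissonSolution F x) (hy : IsPoissonSolution F y) :
    D.energy (x - y) (x - y) = 0 := by
  have hmem := sub_mem hx.1 hy.1
  rw [energy_comm, map_sub, energy_comm, hx.2 _ hmem, energy_comm, hy.2 _ hmem, sub_self]

theorem one (h : ¬ D.ConstantsControlled) : IsPoissonSolution 0 D.one :=
  ⟨one_mem_V h, fun v _ => by
    rw [energy_one_of_not_controlled h, inner_zero_left, neg_zero]⟩

end IsPoissonSolution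

theorem existsUnique_isPoissonSolution (h : D.ConstantsControlled) (F : D.L2) :
    ∃! x, IsPoissonSolution F x := by
  obtain ⟨C, hC, hle⟩ := exists_norm_sq_le_energy h
  obtain ⟨x, hx⟩ := exists_mem_forall_eq_of_coercive isClosed_V hC (fun x hx => hle x hx.1)
    (-(innerSL ℝ F ∘L val))
  refine ⟨x, hx, fun y hy => ?_⟩
  have hnorm := hle _ (sub_mem hy.1.1 hx.1.1)
  rw [hy.energy_sub_self hx, mul_zero] at hnorm
  exact sub_eq_zero.1 (norm_eq_zero.1 (pow_eq_zero_iff two_ne_zero |>.1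
    (hnorm.antisymm (by simp))))

theorem exists_isPoissonSolution (h : ¬ D.ConstantsControlled) {F : D.L2}
    (hF : inner ℝ (val D.one) F = 0) : ∃ x, IsPoissonSolution F x := by
  obtain ⟨C, hC, hle⟩ := D.exists_norm_sub_mean_smul_one_sq_le_energy
  let W : Submodule ℝ D.GraphSpace := D.V ⊓ (D.mean ∘L val).ker
  have hW : IsClosed (W : Set D.GraphSpace) :=
    isClosed_V.inter (ContinuousLinearMap.isClosed_ker _)
  have hcoercive : ∀ x ∈ W, ‖x‖ ^ 2 ≤ C * D.energy x x := fun x ⟨hx, hmean⟩ => by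
    have hmean' : D.mean (val x) = 0 := hmean
    simpa only [hmean', zero_smul, sub_zero] using hle x hx.1
  obtain ⟨x, hx, hsol⟩ := exists_mem_forall_eq_of_coercive hW hC hcoercive (-(innerSL ℝ F ∘L val))
  refine ⟨x, hx.1, fun v hv => ?_⟩
  have hmem : v - D.mean (val v) • D.one ∈ W := by
    refine ⟨sub_mem hv (Submodule.smul_mem _ _ (one_mem_V h)), ?_⟩
    simp [mean_val_one]
  have hv' : D.energy x (v - D.mean (val v) • D.one) =
    -inner ℝ F (val (v - D.mean (val v) • D.one)) := hsol _ hmem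
  rwa [map_sub, map_sub, map_smul, map_smul, energy_comm x D.one, energy_one_of_not_controlled h,
    inner_sub_right, inner_smul_right, ← real_inner_comm F (val D.one), hF, smul_zero, mul_zero,
    sub_zero, sub_zero] at hv'

theorem isInvLaplacian_iff {f : Plane → ℝ} {F : D.L2} (hF : F =ᵐ[volume.restrict D.Ω] f)
    {u : D.L2} : D.IsInvLaplacian f u ↔ ∃ x, IsPoissonSolution F x ∧ val x = u := by
  constructor
  · rintro ⟨G, g, hadm, hweak⟩
    have hmem := triple_mem_V hadm
    refine ⟨triple u G g, ⟨hmem, fun v hv => ?_⟩, rfl⟩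
    rw [← form_eq_energy hmem, inner_eq_integral_mul hF]
    exact hweak _ _ _ (mem_V_iff.1 hv)
  · rintro ⟨x, ⟨hx, hweak⟩, rfl⟩
    refine ⟨grad x, trace x, mem_V_iff.1 hx, fun v Gv gv hv => ?_⟩
    have hsol := hweak _ (triple_mem_V hv)
    rwa [← form_eq_energy hx, inner_eq_integral_mul hF] at hsol

theorem existsUnique_isInvLaplacian (h : D.ConstantsControlled) {f : Plane → ℝ}
    (hf : MemLp f 2 (volume.restrict D.Ω)) : ∃! q : D.L2, D.IsInvLaplacian f q := by
  obtain ⟨x, hx, huniq⟩ := existsUnique_isPoissonSolution h (hf.toLp f)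
  refine ⟨val x, (isInvLaplacian_iff hf.coeFn_toLp).2 ⟨x, hx, rfl⟩, fun u hu => ?_⟩
  obtain ⟨y, hy, rfl⟩ := (isInvLaplacian_iff hf.coeFn_toLp).1 hu
  rw [huniq y hy]

theorem invLaplacianModConst (h : ¬ D.ConstantsControlled) {f : Plane → ℝ}
    (hf : MemLp f 2 (volume.restrict D.Ω)) (hmean : ∫ x in D.Ω, f x = 0) :
    D.InvLaplacianModConst f := by
  obtain ⟨x, hx⟩ := exists_isPoissonSolution h (F := hf.toLp f)
    (by rw [inner_val_one, integral_congr_ae hf.coeFn_toLp, hmean])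
  refine ⟨val x, fun u => ?_⟩
  rw [isInvLaplacian_iff hf.coeFn_toLp]
  constructor
  · rintro ⟨y, hy, rfl⟩
    have hdiff := eq_mean_smul_one_of_energy_self_eq_zero (sub_mem hy.1.1 hx.1.1)
      (hy.energy_sub_self hx)
    refine ⟨D.mean (val (y - x)), ?_⟩
    rw [const_eq_smul_val_one, ← map_smul, ← hdiff, ← map_add, add_sub_cancel]
  · rintro ⟨k, rfl⟩
    refine ⟨x + k • D.one, ?_, by rw [map_add, map_smul, const_eq_smul_val_one]⟩
    simpa only [smul_zero, add_zero] using hx.add ((IsPoissonSolution.one h).const_smul k)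

end PoissonProblem

/-! ### The evolution problem -/

section EvolutionProblem

variable {D : Setting} {I : Set ℝ} {f f₁ f₂ : Plane → ℝ} {F F₁ F₂ : D.L2} {T T₁ T₂ : ℝ → D.L2}

theorem isSolution_iff (hF : F =ᵐ[volume.restrict D.Ω] f) :
    D.IsSolution I f T ↔ ∃ (T' : ℝ → D.L2) (X : ℝ → D.GraphSpace), (∀ z, val (X z) = T z) ∧
      (∀ z ∈ I, HasDerivWithinAt T (T' z) I z) ∧ ContinuousOn T' I ∧
      ContinuousOn (fun z => grad (X z)) I ∧ (∀ z ∈ I, X z ∈ D.V) ∧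
      ∀ v ∈ D.V, ∀ z ∈ I, HasDerivWithinAt (fun t => inner ℝ (mulL2 D.c_bdd (T' t)) (val v))
        (D.energy (X z) v + inner ℝ (mulL2 D.h_bdd (T' z)) (val v) + inner ℝ F (val v)) I z := by
  simp_rw [inner_eq_integral_mul (coeFn_mulL2 _ _), inner_eq_integral_mul hF, smul_eq_mul]
  constructor
  · rintro ⟨T', G, g, hT', hT'_cont, hG_cont, hadm, hweak⟩
    have hX : ∀ z ∈ I, triple (T z) (G z) (g z) ∈ D.V := fun z hz => triple_mem_V (hadm z hz)
    refine ⟨T', fun z => triple (T z) (G z) (g z), fun _ => rfl, hT', hT'_cont, hG_cont, hX,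
      fun v hv z hz => ?_⟩
    rw [← form_eq_energy (hX z hz)]
    exact hweak _ _ _ (mem_V_iff.1 hv) z hz
  · rintro ⟨T', X, hval, hT', hT'_cont, hG_cont, hX, hweak⟩
    refine ⟨T', fun z => grad (X z), fun z => trace (X z), hT', hT'_cont, hG_cont,
      fun z hz => hval z ▸ mem_V_iff.1 (hX z hz), fun v Gv gv hv z hz => ?_⟩
    have hsol := hweak _ (triple_mem_V hv) z hz
    rwa [← form_eq_energy (hX z hz)] at hsol

theorem IsSolution.add_const_smul (hf₁ : MemLp f₁ 2 (volume.restrict D.Ω))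
    (hf₂ : MemLp f₂ 2 (volume.restrict D.Ω)) (h₁ : D.IsSolution I f₁ T₁)
    (h₂ : D.IsSolution I f₂ T₂) (k : ℝ) :
    D.IsSolution I (fun x => f₁ x + k * f₂ x) (fun z => T₁ z + k • T₂ z) := by
  have hF : hf₁.toLp f₁ + k • hf₂.toLp f₂ =ᵐ[volume.restrict D.Ω] fun x => f₁ x + k * f₂ x :=
    (hf₁.add (hf₂.const_smul k)).coeFn_toLp
  obtain ⟨T₁', X₁, hval₁, hd₁, hT₁, hG₁, hX₁, hweak₁⟩ := (isSolution_iff hf₁.coeFn_toLp).1 h₁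
  obtain ⟨T₂', X₂, hval₂, hd₂, hT₂, hG₂, hX₂, hweak₂⟩ := (isSolution_iff hf₂.coeFn_toLp).1 h₂
  refine (isSolution_iff hF).2 ⟨fun z => T₁' z + k • T₂' z, fun z => X₁ z + k • X₂ z,
    fun z => by rw [map_add, map_smul, hval₁, hval₂],
    fun z hz => (hd₁ z hz).add ((hd₂ z hz).const_smul k), hT₁.add (hT₂.const_smul k), ?_,
    fun z hz => add_mem (hX₁ z hz) (Submodule.smul_mem _ _ (hX₂ z hz)), fun v hv z hz => ?_⟩
  · simp only [map_add, map_smul]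
    exact hG₁.add (hG₂.const_smul k)
  · have hflux := (hweak₁ v hv z hz).add ((hweak₂ v hv z hz).const_mul k)
    simp only [map_add, map_smul, add_apply, smul_apply, inner_add_left, real_inner_smul_left,
      smul_eq_mul]
    exact hflux.congr_deriv (by ring)

theorem reduces_of_isSolution (hf : MemLp f 2 (volume.restrict D.Ω)) (hT : D.IsSolution I f T) :
    D.Reduces I f T := by
  refine ⟨hT, fun T' => ⟨fun hT' => ?_, fun hT' => ?_⟩⟩
  · simpa [sub_eq_add_neg] using hT'.add_const_smul hf hf hT (-1)
  · simpa using IsSolution.add_const_smul MemLp.zero hf hT' hT 1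

theorem isSolution_quadratic {x₀ x₁ x₂ : D.GraphSpace} (hF : F =ᵐ[volume.restrict D.Ω] f)
    (h₂ : IsPoissonSolution 0 x₂) (h₁ : IsPoissonSolution (mulL2 D.h_bdd (val x₂)) x₁)
    (h₀ : IsPoissonSolution (F + mulL2 D.h_bdd (val x₁) - mulL2 D.c_bdd (val x₂)) x₀) :
    D.IsSolution I f (fun z => (z ^ 2 / 2) • val x₂ + z • val x₁ + val x₀) := by
  have hX : ∀ z : ℝ, IsPoissonSolution _ ((z ^ 2 / 2) • x₂ + z • x₁ + x₀) :=
    fun z => ((h₂.const_smul _).add (h₁.const_smul z)).add h₀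
  refine (isSolution_iff hF).2 ⟨fun z => z • val x₂ + val x₁,
    fun z => (z ^ 2 / 2) • x₂ + z • x₁ + x₀, fun z => by simp only [map_add, map_smul],
    fun z _ => ?_, by fun_prop, by fun_prop, fun z _ => (hX z).1, fun v hv z _ => ?_⟩
  · have hsq : HasDerivAt (fun z : ℝ => z ^ 2 / 2) z z := by
      simpa using (hasDerivAt_pow 2 z).div_const 2
    have hid := (hasDerivAt_id z).smul_const (val x₁)
    rw [one_smul] at hid
    exact (((hsq.smul_const (val x₂)).add hid).add_const (val x₀)).hasDerivWithinAt
  · have hflux := (((hasDerivAt_id z).mul_const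
      (inner ℝ (mulL2 D.c_bdd (val x₂)) (val v))).add_const
      (inner ℝ (mulL2 D.c_bdd (val x₁)) (val v))).hasDerivWithinAt (s := I)
    rw [(hX z).2 v hv]
    simp only [map_add, map_smul, inner_add_left, inner_sub_left, real_inner_smul_left, smul_zero,
      zero_add]
    exact hflux.congr_deriv (by ring)

theorem reduces_of_isInvLaplacian (hf : MemLp f 2 (volume.restrict D.Ω)) {q : D.L2}
    (hq : D.IsInvLaplacian f q) : D.Reduces I f (fun _ => q) := by
  obtain ⟨x, hx, rfl⟩ := (isInvLaplacian_iff hf.coeFn_toLp).1 hq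
  have hzero : IsPoissonSolution (mulL2 D.h_bdd (val 0)) (0 : D.GraphSpace) := by
    simpa using IsPoissonSolution.zero
  refine reduces_of_isSolution hf ?_
  simpa using isSolution_quadratic (I := I) hf.coeFn_toLp .zero hzero (by simpa using hx)

theorem coeFn_mulL2_val_one {a : Plane → ℝ} (ha : MemLp a ∞ (volume.restrict D.Ω)) :
    mulL2 ha (val D.one) =ᵐ[volume.restrict D.Ω] a := by
  filter_upwards [coeFn_mulL2 ha (val D.one), coeFn_val_one (D := D)] with x hx hone
  rw [hx, hone, smul_eq_mul, mul_one]

theorem reduces_of_isInvLaplacian_add_mul (hc : ¬ D.ConstantsControlled)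
    (hf : MemLp f 2 (volume.restrict D.Ω)) {α : ℝ} {q : D.L2}
    (hq : D.IsInvLaplacian (fun x => f x + α * D.h x) q) :
    D.Reduces I f (fun z => D.const (α * z) + q) := by
  have hsource : hf.toLp f + mulL2 D.h_bdd (val (α • D.one)) =ᵐ[volume.restrict D.Ω]
      fun x => f x + α * D.h x := by
    rw [map_smul, map_smul]
    filter_upwards [Lp.coeFn_add (hf.toLp f) (α • mulL2 D.h_bdd (val D.one)), hf.coeFn_toLp,
      Lp.coeFn_smul α (mulL2 D.h_bdd (val D.one)), coeFn_mulL2_val_one D.h_bdd]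
      with x hadd hf_x hsmul hh
    rw [hadd, Pi.add_apply, hf_x, hsmul, Pi.smul_apply, hh, smul_eq_mul]
  obtain ⟨x, hx, rfl⟩ := (isInvLaplacian_iff hsource).1 hq
  have hone : IsPoissonSolution (mulL2 D.h_bdd (val 0)) (α • D.one) := by
    simpa using (IsPoissonSolution.one hc).const_smul α
  refine reduces_of_isSolution hf ?_
  simpa [const_eq_smul_val_one, smul_smul, mul_comm α] using
    isSolution_quadratic (I := I) hf.coeFn_toLp .zero hone (by simpa using hx)

theorem reduces_of_isInvLaplacian_sub_mul (hc : ¬ D.ConstantsControlled)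
    (hf : MemLp f 2 (volume.restrict D.Ω)) {α : ℝ} {w q : D.L2} (hw : D.IsInvLaplacian D.h w)
    (hq : D.IsInvLaplacian (fun x => f x - α * (D.c x - D.h x * w x)) q) :
    D.Reduces I f (fun z => α • (D.const (z ^ 2 / 2) + z • w) + q) := by
  obtain ⟨y, hy, rfl⟩ := (isInvLaplacian_iff (coeFn_mulL2_val_one D.h_bdd)).1 hw
  have hsource : hf.toLp f + mulL2 D.h_bdd (val (α • y)) - mulL2 D.c_bdd (val (α • D.one))
      =ᵐ[volume.restrict D.Ω] fun x => f x - α * (D.c x - D.h x * val y x) := by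
    have hsplit : hf.toLp f + mulL2 D.h_bdd (val (α • y)) - mulL2 D.c_bdd (val (α • D.one)) =
        hf.toLp f - α • (mulL2 D.c_bdd (val D.one) - mulL2 D.h_bdd (val y)) := by
      simp only [map_smul, smul_sub]
      abel
    rw [hsplit]
    filter_upwards [Lp.coeFn_sub (hf.toLp f) (α • (mulL2 D.c_bdd (val D.one) -
        mulL2 D.h_bdd (val y))), hf.coeFn_toLp, Lp.coeFn_smul α (mulL2 D.c_bdd (val D.one) -
        mulL2 D.h_bdd (val y)), Lp.coeFn_sub (mulL2 D.c_bdd (val D.one)) (mulL2 D.h_bdd (val y)),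
      coeFn_mulL2_val_one D.c_bdd, coeFn_mulL2 D.h_bdd (val y)] with x hsub hf_x hsmul hsub' hc_x hh
    rw [hsub, Pi.sub_apply, hf_x, hsmul, Pi.smul_apply, hsub', Pi.sub_apply, hc_x, hh, smul_eq_mul,
      smul_eq_mul]
  obtain ⟨x, hx, rfl⟩ := (isInvLaplacian_iff hsource).1 hq
  have hone : IsPoissonSolution 0 (α • D.one) := by
    simpa using (IsPoissonSolution.one hc).const_smul α
  have hy' : IsPoissonSolution (mulL2 D.h_bdd (val (α • D.one))) (α • y) := by
    simpa using hy.const_smul α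
  refine reduces_of_isSolution hf ?_
  simpa [const_eq_smul_val_one, smul_smul, mul_comm α] using
    isSolution_quadratic (I := I) hf.coeFn_toLp hone hy' hx

end EvolutionProblem

section EffectiveSource

variable {D : Setting} {w : D.L2}

theorem memLp_c_sub_mul (w : D.L2) :
    MemLp (fun x => D.c x - D.h x * w x) 2 (volume.restrict D.Ω) :=
  (D.c_bdd.mono_exponent le_top).sub ((Lp.memLp (mulL2 D.h_bdd w)).ae_eq (coeFn_mulL2 _ _))

theorem integral_c_sub_mul (hc : ¬ D.ConstantsControlled) (hw : D.IsInvLaplacian D.h w)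
    {G : Plane → Plane} (hG : IsWeakGradient D.Ω w G) :
    ∫ x in D.Ω, (D.c x - D.h x * w x) =
      (∫ x in D.Ω, D.c x) + ∫ x in D.Ω, D.σ x * ‖G x‖ ^ 2 := by
  obtain ⟨x, hx, rfl⟩ := (isInvLaplacian_iff (coeFn_mulL2_val_one D.h_bdd)).1 hw
  have hgrad := (isWeakGradient_of_mem_H1 hx.1.1).ae_eq D.isOpen hG
  have hself : ∫ y in D.Ω, D.σ y * ‖G y‖ ^ 2 = -∫ y in D.Ω, D.h y * val x y := by
    rw [← inner_eq_integral_mul (coeFn_mulL2_val_one D.h_bdd), ← hx.2 x hx.1,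
      energy_of_not_controlled hc]
    refine integral_congr_ae ?_
    filter_upwards [hgrad] with y hy
    rw [hy, real_inner_self_eq_norm_sq]
  have hmul : MemLp (fun y => D.h y * val x y) 2 (volume.restrict D.Ω) :=
    (Lp.memLp (mulL2 D.h_bdd (val x))).ae_eq (coeFn_mulL2 _ _)
  rw [integral_sub (D.c_bdd.integrable le_top) (hmul.integrable one_le_two), hself, sub_eq_add_neg]

variable (D) in
theorem integral_c_pos : 0 < ∫ x in D.Ω, D.c x := by
  obtain ⟨m, hm, hcm⟩ := D.c_pos
  have hle := integral_mono_ae (integrable_const m) (D.c_bdd.integrable le_top) hcm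
  rw [integral_const, smul_eq_mul] at hle
  have hvol : 0 < (volume.restrict D.Ω).real Set.univ := by
    rw [measureReal_restrict_apply_univ]
    exact ENNReal.toReal_pos (D.isOpen.measure_pos _ D.isConnected.nonempty).ne'
      D.isBounded.measure_lt_top.ne
  exact (mul_pos hvol hm).trans_le hle

theorem integral_c_sub_mul_pos (hc : ¬ D.ConstantsControlled) (hw : D.IsInvLaplacian D.h w) :
    0 < ∫ x in D.Ω, (D.c x - D.h x * w x) := by
  obtain ⟨G, g, hadm, -⟩ := id hw
  obtain ⟨m, hm, hσ⟩ := D.σ_pos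
  rw [integral_c_sub_mul hc hw hadm.grad]
  refine add_pos_of_pos_of_nonneg D.integral_c_pos (integral_nonneg_of_ae ?_)
  filter_upwards [hσ] with x hx
  exact mul_nonneg (hm.le.trans hx) (sq_nonneg _)

theorem integral_sub_mul_c_sub_mul_eq_zero {f : Plane → ℝ}
    (hf : MemLp f 2 (volume.restrict D.Ω)) {α : ℝ}
    (hα : α * ∫ x in D.Ω, (D.c x - D.h x * w x) = ∫ x in D.Ω, f x) :
    ∫ x in D.Ω, (f x - α * (D.c x - D.h x * w x)) = 0 := by
  rw [integral_sub (hf.integrable one_le_two)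
    (((memLp_c_sub_mul w).integrable one_le_two).const_mul α), integral_const_mul, hα, sub_self]

end EffectiveSource

end Setting

end Graetz

end

open Graetz Graetz.Setting in
theorem mainTheorem8_general (D : Setting) (f : Plane → ℝ)
    (hf : MemLp f 2 (volume.restrict D.Ω)) (I : Set ℝ) :
    (D.ConstantsControlled →
      (∃! q : D.L2, D.IsInvLaplacian f q) ∧
      ∀ q : D.L2, D.IsInvLaplacian f q → D.Reduces I f (fun _ => q)) ∧
    (¬ D.ConstantsControlled → (∫ x in D.Ω, D.h x) ≠ 0 →
      (∃! α : ℝ, ∫ x in D.Ω, (f x + α * D.h x) = 0) ∧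
      ∀ α : ℝ, ∫ x in D.Ω, (f x + α * D.h x) = 0 →
        D.InvLaplacianModConst (fun x => f x + α * D.h x) ∧
        ∀ q : D.L2, D.IsInvLaplacian (fun x => f x + α * D.h x) q →
          D.Reduces I f (fun z => D.const (α * z) + q)) ∧
    (¬ D.ConstantsControlled → (∫ x in D.Ω, D.h x) = 0 →
      D.InvLaplacianModConst D.h ∧
      ∀ w : D.L2, D.IsInvLaplacian D.h w →
        (∀ Gw : Plane → Plane, IsWeakGradient D.Ω w Gw →
          ∫ x in D.Ω, (D.c x - D.h x * w x) =
            (∫ x in D.Ω, D.c x) + ∫ x in D.Ω, D.σ x * ‖Gw x‖ ^ 2) ∧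
        0 < ∫ x in D.Ω, (D.c x - D.h x * w x) ∧
        (∃! α : ℝ, α * ∫ x in D.Ω, (D.c x - D.h x * w x) = ∫ x in D.Ω, f x) ∧
        ∀ (α : ℝ) (γ : Plane → ℝ),
          α * ∫ x in D.Ω, (D.c x - D.h x * w x) = ∫ x in D.Ω, f x →
          (γ = fun x => f x - α * (D.c x - D.h x * w x)) →
          MemLp γ 2 (volume.restrict D.Ω) ∧ ∫ x in D.Ω, γ x = 0 ∧
          D.InvLaplacianModConst γ ∧
          ∀ q : D.L2, D.IsInvLaplacian γ q →
            D.Reduces I f (fun z => α • (D.const (z ^ 2 / 2) + z • w) + q)) := by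
  have hh : MemLp D.h 2 (volume.restrict D.Ω) := D.h_bdd.mono_exponent le_top
  refine ⟨fun hc => ⟨existsUnique_isInvLaplacian hc hf, fun q => reduces_of_isInvLaplacian hf⟩,
    fun hc hne => ⟨?_, fun α hα => ⟨?_, fun q => reduces_of_isInvLaplacian_add_mul hc hf⟩⟩,
    fun hc hmean => ⟨invLaplacianModConst hc hh hmean, fun w hw => ?_⟩⟩
  · exact existsUnique_integral_add_mul_eq_zero (hf.integrable one_le_two)
      (hh.integrable one_le_two) hne
  · exact invLaplacianModConst hc (hf.add (hh.const_mul α)) hα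
  · have hpos := integral_c_sub_mul_pos hc hw
    refine ⟨fun G hG => integral_c_sub_mul hc hw hG, hpos,
      (mulRight_bijective₀ _ hpos.ne').existsUnique _, ?_⟩
    rintro α γ hα rfl
    have hγ := hf.sub ((memLp_c_sub_mul w).const_mul α)
    have hγ_mean := integral_sub_mul_c_sub_mul_eq_zero hf hα
    exact ⟨hγ, hγ_mean, invLaplacianModConst hc hγ hγ_mean,
      fun q => reduces_of_isInvLaplacian_sub_mul hc hf hw⟩

theorem mainTheorem8 (D : Graetz.Setting) (gradh : Graetz.Plane → Graetz.Plane)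
    (hgrad : Graetz.IsWeakGradient D.Ω D.h gradh) (μ f : Graetz.Plane → ℝ)
    (hf : f = Graetz.viscousSource μ gradh)
    (hfL2 : MemLp f 2 (volume.restrict D.Ω))
    (I : Set ℝ) (hI : I.OrdConnected) (hI' : I.Nontrivial) :
    -- the constants are controlled
    (D.ConstantsControlled →
      (∃! q : D.L2, D.IsInvLaplacian f q) ∧
      ∀ q : D.L2, D.IsInvLaplacian f q → D.Reduces I f (fun _ => q)) ∧
    -- the constants are not controlled, non-balanced case
    (¬ D.ConstantsControlled → (∫ x in D.Ω, D.h x) ≠ 0 →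
      (∃! α : ℝ, ∫ x in D.Ω, (f x + α * D.h x) = 0) ∧
      ∀ α : ℝ, ∫ x in D.Ω, (f x + α * D.h x) = 0 →
        D.InvLaplacianModConst (fun x => f x + α * D.h x) ∧
        ∀ q : D.L2, D.IsInvLaplacian (fun x => f x + α * D.h x) q →
          D.Reduces I f (fun z => D.const (α * z) + q)) ∧
    -- the constants are not controlled, balanced case
    (¬ D.ConstantsControlled → (∫ x in D.Ω, D.h x) = 0 →
      D.InvLaplacianModConst D.h ∧
      ∀ w : D.L2, D.IsInvLaplacian D.h w →
        (∀ Gw : Graetz.Plane → Graetz.Plane, Graetz.IsWeakGradient D.Ω w Gw →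
          ∫ x in D.Ω, (D.c x - D.h x * w x) =
            (∫ x in D.Ω, D.c x) + ∫ x in D.Ω, D.σ x * ‖Gw x‖ ^ 2) ∧
        0 < ∫ x in D.Ω, (D.c x - D.h x * w x) ∧
        (∃! α : ℝ, α * ∫ x in D.Ω, (D.c x - D.h x * w x) = ∫ x in D.Ω, f x) ∧
        ∀ (α : ℝ) (γ : Graetz.Plane → ℝ),
          α * ∫ x in D.Ω, (D.c x - D.h x * w x) = ∫ x in D.Ω, f x →
          (γ = fun x => f x - α * (D.c x - D.h x * w x)) →
          MemLp γ 2 (volume.restrict D.Ω) ∧ ∫ x in D.Ω, γ x = 0 ∧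
          D.InvLaplacianModConst γ ∧
          ∀ q : D.L2, D.IsInvLaplacian γ q →
            D.Reduces I f (fun z => α • (D.const (z ^ 2 / 2) + z • w) + q)) :=
  mainTheorem8_general D f hfL2 I
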